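/- Indices $j,k$ are taken modulo $5$ in $\{1,\dots,5\}$. Let $H^5$ be the hypercube graph on $(\mathbb Z/2)^5$, where an edge has color $j$ if its ends differ exactly in coordinate $j$, with rainbow (cyclic order of colors) $(1,2,3,4,5)$. A height on $H^5$ is a function $h\colon (\mathbb Z/2)^5\to\mathbb Z_{\ge 0}$ with $|h(v)-h(v')|=1$ for adjacent $v,v'$. Discrete Morse divisor. For each $4$-cycle with colors $j,j+1$ add a face center $f_{j,j+1}$; write $f_{j,j+1}(v)$ for the center of the $(j,j+1)$-cycle through $v$. The cycle is a bow tie for $h$ if $h$ takes exactly two values on it, and then its center is given the average height of the four corners. Let $D_h=\sum_v\kappa_v v+\sum_f\kappa_f f$, over all vertices $v$ and all centers $f$ of bow ties. Here $\lambda$ is the number of sign changes, in cyclic order, of the differences between the heights of the neighbors (for a vertex, the neighbors along colors $1,\dots,5$; for a bow-tie center, the four corners) and the height of the point itself; $\kappa=-1$ if $\lambda=0$, and $\kappa=\mu$ if $\lambda=2+2\mu$. Let $D_1=D_{h_1}$, where $h_1$ is obtained from the fully extended height $v\mapsto\#\{i: v_i=1\}$ by lowering the top vertex $\mathbf 1=(1,1,1,1,1)$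 from height $5$ to height $3$. The curve. Let $\phi=(1+\sqrt5)/2$, $\zeta=e^{2\pi i/10}$, and let $X\subset\mathbb P^4(\mathbb C)$ be the curve $$x_1^2+x_2^2+x_3^2=0,\quad \phi x_1^2+x_2^2+x_4^2=0,\quad (\phi+1)x_1^2+x_2^2+x_5^2=0 .$$ Let $\eta(z)=\frac{z-\zeta}{z-\zeta^{-1}}\cdot\frac{\zeta^3-\zeta^{-1}}{\zeta-\zeta^3}$ and $p=\eta^{-1}\circ\pi\colon X\to\mathbb P^1$ with $\pi(x)=x_2^2/x_1^2$. An embedding of $H^5$ in $X$ is an injective map $v\mapsto\mathbf v$ from vertices to $X$, together with a map $f\mapsto \mathbf f$ from face centers to $X$, such that for all $v,j$: the images of the two ends of the edge of color $j$ at $v$ are the two endpoints of a lift under $p$ of the ray $\{t\zeta^{2j}: 0\le t\le\infty\}$; and the image of $f_{j,j+1}(v)$ is the endpoint of a lift, starting at $\mathbf v$, of the segment of the ray through $\zeta^{2j+1}$ from $p(\mathbf v)\in\{0,\infty\}$ to $\zeta^{2j+1}$. The elliptic curves. Over $\mathbb C$ let $E_1,E_4\colon y^2=x(x-1)(x-\phi-1)$,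 $E_2,E_5\colon y^2=x(x-1)(x-\phi)$, $E_3\colon y^2=x(x-1)(x+\phi)$, and let $\nu_k\colon X\to E_k$ be given by $$\nu_1=\Big(-(2\phi+1)\tfrac{x_1^2}{x_5^2}-\phi,\ (2\phi+1)\tfrac{x_2x_3x_4}{x_5^3}\Big),\qquad \nu_2=\Big(\tfrac{x_2^2}{x_1^2}+\phi+1,\ i\tfrac{x_3x_4x_5}{x_1^3}\Big),$$ $$\nu_3=\Big((2\phi+1)\tfrac{x_3^2}{x_2^2}+\phi+1,\ i(2\phi+1)\tfrac{x_1x_4x_5}{x_2^3}\Big),\qquad \nu_4=\Big((\phi+1)\tfrac{x_4^2}{x_3^2}-\phi,\ i\phi\tfrac{x_1x_2x_5}{x_3^3}\Big),$$ $$\nu_5=\Big(-\tfrac{x_5^2}{x_4^2}+\phi+1,\ i\tfrac{x_1x_2x_3}{x_4^3}\Big),$$ with value the identity $O_k$ where the denominator vanishes. Given an embedding, carry $D_h$ to $X$ and extend $\nu_k$ linearly to get $\nu_k(D_h)\in E_k$. Put $e^k_\infty=\nu_k(\mathbf 1)$ (the image under $\nu_k$ of the point of $X$ assigned to the vertex $(1,1,1,1,1)$)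 and $e^k_4=\nu_k(\mathbf f)$ for $f=f_{k-2,k-1}(1,1,1,1,1)$. Corollary. Embeddings of $H^5$ in $X$ exist. For every such embedding and every $k\in\{1,\dots,5\}$, the subgroup of $E_k$ generated by all $\nu_k(D_h)$, $h$ a height on $H^5$, is the cyclic group generated by $\nu_k(D_1)$; moreover $\nu_k(D_1)=e^k_\infty-e^k_4$, and this subgroup is isomorphic to $\mathbb Z$. -/

import Mathlib

open scoped LinearAlgebra.Projectivization goldenRatio

namespace Adinkra

/-! ### The hypercube, its rainbow and its height functions -/

/-- The edge colours `1, …, 5` of the `5`-cube, in their rainbow (cyclic) order; arithmetic is modulo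
`5` and the numeral `5` denotes the same element as `0`.  The homogeneous coordinates `x₁, …, x₅` and
the elliptic curves `E₁, …, E₅` are indexed in the same way. -/
abbrev Color : Type := Fin 5

/-- Vertices of the hypercube `H⁵`. -/
abbrev Vertex : Type := Color → ZMod 2

/-- The neighbour of `v` along the edge of colour `j`. -/
def nbr (v : Vertex) (j : Color) : Vertex := v + Pi.single j 1

/-- Height functions on `H⁵`: they change by exactly one along every edge. -/
def IsHeight (h : Vertex → ℕ) : Prop :=
  ∀ (v : Vertex) (j : Color), |(h (nbr v j) : ℤ) - (h v : ℤ)| = 1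

/-- The fully extended height whose only pinned vertex is `(1,1,1,1,1)`. -/
def heightFE : Vertex → ℕ := fun v => ∑ i, (v i).val

/-- The height obtained from the fully extended height by lowering the top vertex `(1,1,1,1,1)`. -/
def heightOne : Vertex → ℕ := fun v => if v = 1 then heightFE v - 2 else heightFE v

/-! ### Faces and the discrete Morse divisor -/

/-- A two-coloured `4`-cycle with consecutive colours `j, j + 1`.  It is recorded by `j` and its
unique vertex whose coordinates `j` and `j + 1` both vanish. -/
abbrev Face : Type := {f : Color × Vertex // f.2 f.1 = 0 ∧ f.2 (f.1 + 1) = 0}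

/-- The `4`-cycle with colours `j, j + 1` through the vertex `v`. -/
def face (j : Color) (v : Vertex) : Face :=
  ⟨(j, fun i => if i = j ∨ i = j + 1 then 0 else v i), by simp⟩

/-- The four vertices of a face in cyclic order. -/
def Face.cycle (f : Face) : Fin 4 → Vertex :=
  ![f.1.2, nbr f.1.2 f.1.1, nbr (nbr f.1.2 f.1.1) (f.1.1 + 1), nbr f.1.2 (f.1.1 + 1)]

/-- A face is a bow tie if exactly two heights occur on it (otherwise it is a diamond). -/
def Face.IsBowTie (f : Face) (h : Vertex → ℕ) : Prop :=
  (Finset.univ.image fun i => h (f.cycle i)).card = 2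

instance (f : Face) (h : Vertex → ℕ) : Decidable (f.IsBowTie h) := by
  unfold Face.IsBowTie; infer_instance

/-- The number of sign changes in a cyclic sequence of numbers. -/
def signChanges {n : ℕ} [NeZero n] (d : Fin n → ℚ) : ℕ :=
  (Finset.univ.filter fun i => SignType.sign (d i) ≠ SignType.sign (d (i + 1))).card

/-- The coefficient of a mesh vertex whose neighbours, in cyclic order, have relative heights `d`:
it is `-1` if there is no sign change (local minimum or maximum) and `μ` if there are `2 + 2 μ` sign
changes. -/
def morseCoeff {n : ℕ} [NeZero n] (d : Fin n → ℚ) : ℤ :=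
  if signChanges d = 0 then -1 else ((signChanges d : ℤ) - 2) / 2

/-- The discrete Morse divisor of a height, a formal sum of vertices and face centres.  The centre of
a bow tie is a mesh vertex, with the average height of the four corners as its height; the centre of a
diamond is not a mesh vertex. -/
noncomputable def morseDivisor (h : Vertex → ℕ) : (Vertex ⊕ Face) →₀ ℤ :=
  Finsupp.equivFunOnFinite.symm fun m =>
    match m with
    | .inl v => morseCoeff fun j : Color => (h (nbr v j) : ℚ) - h v
    | .inr f =>
      if f.IsBowTie h then
        morseCoeff fun i : Fin 4 => (h (f.cycle i) : ℚ) - (∑ l, (h (f.cycle l) : ℚ)) / 4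
      else 0

/-! ### The curve and its map to the beach ball -/

/-- The golden ratio as a complex number. -/
noncomputable def phi : ℂ := (φ : ℝ)

/-- The primitive tenth root of unity `exp (2 π i / 10)`. -/
noncomputable def zeta : ℂ := Complex.exp (2 * Real.pi * Complex.I / 10)

/-- The homogeneous equations of the curve. -/
def OnCurve (x : Color → ℂ) : Prop :=
  x 1 ^ 2 + x 2 ^ 2 + x 3 ^ 2 = 0 ∧
  phi * x 1 ^ 2 + x 2 ^ 2 + x 4 ^ 2 = 0 ∧
  (phi + 1) * x 1 ^ 2 + x 2 ^ 2 + x 5 ^ 2 = 0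

/-- The equations do not depend on the choice of homogeneous coordinates. -/
theorem onCurve_smul {x : Color → ℂ} (hx : OnCurve x) (c : ℂ) : OnCurve (c • x) := by
  obtain ⟨h1, h2, h3⟩ := hx
  simp only [OnCurve, Pi.smul_apply, smul_eq_mul]
  exact ⟨by linear_combination c ^ 2 * h1, by linear_combination c ^ 2 * h2,
    by linear_combination c ^ 2 * h3⟩

/-- The generalized Fermat curve of genus `5` in the projective space of dimension `4`. -/
def Curve : Type := {p : ℙ ℂ (Color → ℂ) // OnCurve p.rep}

/-- The point `x` lies over the point `[u : w]` of the beach ball, that is,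
`π(x) = [x₁² : x₂²]` equals `[1 : η(z)]` with `z = u / w` and the Möbius transformation
`η(z) = (z - ζ) / (z - ζ⁻¹) * ((ζ³ - ζ⁻¹) / (ζ - ζ³))`. -/
def LiesOver (x : Color → ℂ) (u w : ℂ) : Prop :=
  x 2 ^ 2 * ((u - zeta⁻¹ * w) * (zeta - zeta ^ 3)) =
    x 1 ^ 2 * ((u - zeta * w) * (zeta ^ 3 - zeta⁻¹))

/-- `P` and `Q` are the start and the end of a lift to the curve of the path
`t ↦ [z t]`, `t ∈ [0, 1]`, on the beach ball; the lift is given by continuous homogeneous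
coordinates. -/
def JoinedOver (z : unitInterval → ℂ × ℂ) (P Q : Curve) : Prop :=
  ∃ (γ : C(unitInterval, Color → ℂ)) (hγ : ∀ t, γ t ≠ 0),
    (∀ t, OnCurve (γ t) ∧ LiesOver (γ t) (z t).1 (z t).2) ∧
    P.1 = Projectivization.mk ℂ (γ 0) (hγ 0) ∧ Q.1 = Projectivization.mk ℂ (γ 1) (hγ 1)

/-- The ray through `ζ ^ (2 j)` from `0` to `∞`. -/
noncomputable def edgeRay (j : Color) (t : unitInterval) : ℂ × ℂ :=
  (((t : ℝ) : ℂ) * zeta ^ (2 * j.val), 1 - ((t : ℝ) : ℂ))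

/-- The segment from `0` to `ζ ^ (2 j + 1)`. -/
noncomputable def blackRay (j : Color) (t : unitInterval) : ℂ × ℂ :=
  (((t : ℝ) : ℂ) * zeta ^ (2 * j.val + 1), 1)

/-- The part of the ray through `ζ ^ (2 j + 1)` from `∞` to `ζ ^ (2 j + 1)`. -/
noncomputable def whiteRay (j : Color) (t : unitInterval) : ℂ × ℂ :=
  (zeta ^ (2 * j.val + 1), ((t : ℝ) : ℂ))

/-- The embeddings of `H⁵` with its face centres in the curve.  An edge of colour `j` is a lift of the
ray through `ζ ^ (2 j)`, and joins a black vertex (over `0`) to a white vertex (over `∞`).  The centre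
of the `(j, j + 1)`-face at `v` is the point over `ζ ^ (2 j + 1)` that is reached from `v` along the
bisector of the sector between the rays of colours `j` and `j + 1`.  An embedding is determined
by the image of a single vertex, which may be any of the `32` points over `0` and `∞`. -/
structure Embedding where
  vertex : Vertex → Curve
  center : Face → Curve
  injective : Function.Injective vertex
  edge : ∀ (v : Vertex) (j : Color),
    JoinedOver (edgeRay j) (vertex v) (vertex (nbr v j)) ∨
    JoinedOver (edgeRay j) (vertex (nbr v j)) (vertex v)
  center_adj : ∀ (v : Vertex) (j : Color),
    JoinedOver (blackRay j) (vertex v) (center (face j v)) ∨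
    JoinedOver (whiteRay j) (vertex v) (center (face j v))

/-! ### The elliptic curves and the maps to them -/

/-- The third root `r` in the equation `y² = x (x - 1) (x - r)` of `E k`
(`φ + 1` for `k = 1, 4`, `φ` for `k = 2, 5`, and `-φ` for `k = 3`). -/
noncomputable def root (k : Color) : ℂ :=
  match k with
  | 0 => phi
  | 1 => phi + 1
  | 2 => phi
  | 3 => -phi
  | 4 => phi + 1

/-- The elliptic curve `y² = x (x - 1) (x - r)` over `ℂ`. -/
noncomputable def E (k : Color) : WeierstrassCurve.Affine ℂ where
  a₁ := 0
  a₂ := -(1 + root k)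
  a₃ := 0
  a₄ := root k
  a₆ := 0

theorem phi_sq : phi ^ 2 = phi + 1 := by
  unfold phi
  exact_mod_cast Real.goldenRatio_sq

theorem phi_ne_zero : phi ≠ 0 := by
  unfold phi
  exact_mod_cast Real.goldenRatio_ne_zero

theorem root_ne (k : Color) : root k ≠ 0 ∧ root k ≠ 1 := by
  have h0 := phi_ne_zero
  have h2 := phi_sq
  have hp1 : phi + 1 ≠ 0 := by rw [← h2]; exact pow_ne_zero 2 h0
  have h1 : phi ≠ 1 := by
    intro h
    rw [h] at h2
    norm_num at h2
  fin_cases k <;> simp only [root]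
  · exact ⟨h0, h1⟩
  · exact ⟨hp1, by simpa using h0⟩
  · exact ⟨h0, h1⟩
  · refine ⟨neg_ne_zero.mpr h0, fun h => hp1 ?_⟩
    linear_combination -h
  · exact ⟨hp1, by simpa using h0⟩

theorem E_disc_ne (k : Color) : (E k).Δ ≠ 0 := by
  have h := root_ne k
  have : (E k).Δ = 16 * root k ^ 2 * (root k - 1) ^ 2 := by
    simp only [E, WeierstrassCurve.Δ, WeierstrassCurve.b₂, WeierstrassCurve.b₄,
      WeierstrassCurve.b₆, WeierstrassCurve.b₈]
    ring
  rw [this]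
  exact mul_ne_zero (mul_ne_zero (by norm_num) (pow_ne_zero _ h.1))
    (pow_ne_zero _ (sub_ne_zero.mpr h.2))

/-- The `x`-coordinate of `ν_k`; the case `0` is `k = 5`. -/
noncomputable def nuX (k : Color) (x : Color → ℂ) : ℂ :=
  match k with
  | 1 => -(2 * phi + 1) * (x 1 ^ 2 / x 5 ^ 2) - phi
  | 2 => x 2 ^ 2 / x 1 ^ 2 + phi + 1
  | 3 => (2 * phi + 1) * (x 3 ^ 2 / x 2 ^ 2) + phi + 1
  | 4 => (phi + 1) * (x 4 ^ 2 / x 3 ^ 2) - phi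
  | 0 => -(x 5 ^ 2 / x 4 ^ 2) + phi + 1

/-- The `y`-coordinate of `ν_k`; the case `0` is `k = 5`. -/
noncomputable def nuY (k : Color) (x : Color → ℂ) : ℂ :=
  match k with
  | 1 => (2 * phi + 1) * (x 2 * x 3 * x 4 / x 5 ^ 3)
  | 2 => Complex.I * (x 3 * x 4 * x 5 / x 1 ^ 3)
  | 3 => Complex.I * (2 * phi + 1) * (x 1 * x 4 * x 5 / x 2 ^ 3)
  | 4 => Complex.I * phi * (x 1 * x 2 * x 5 / x 3 ^ 3)
  | 0 => Complex.I * (x 1 * x 2 * x 3 / x 4 ^ 3)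

theorem nu_equation (k : Color) (x : Color → ℂ) (hx : OnCurve x) (hk : x (k - 1) ≠ 0) :
    (E k).Equation (nuX k x) (nuY k x) := by
  obtain ⟨h1, h2, h3⟩ := hx
  have hp := phi_sq
  have hI := Complex.I_sq
  rw [WeierstrassCurve.Affine.equation_iff]
  fin_cases k
  · replace hk : x 4 ≠ 0 := hk
    simp only [nuX, nuY, E, root]
    field_simp
    grind
  · replace hk : x 5 ≠ 0 := hk
    simp only [nuX, nuY, E, root]
    field_simp
    grind
  · replace hk : x 1 ≠ 0 := hk
    simp only [nuX, nuY, E, root]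
    field_simp
    grind
  · replace hk : x 2 ≠ 0 := hk
    simp only [nuX, nuY, E, root]
    field_simp
    grind
  · replace hk : x 3 ≠ 0 := hk
    simp only [nuX, nuY, E, root]
    field_simp
    grind

/-- The map `ν_k` from the curve to `E k`.  Its coordinates are homogeneous of degree zero, with poles
exactly where the coordinate in the denominator, `x_(k-1)`, vanishes; such points are sent to the
point at infinity. -/
noncomputable def nu (k : Color) (p : Curve) : (E k).Point :=
  if hk : p.1.rep (k - 1) = 0 then 0
  else .some (nuX k p.1.rep) (nuY k p.1.rep)
    ((WeierstrassCurve.Affine.equation_iff_nonsingular_of_Δ_ne_zero (E_disc_ne k)).mp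
      (nu_equation k p.1.rep p.2 hk))

/-- The `ℤ`-linear extension of `ν_k` to divisors on the curve. -/
noncomputable def nuDiv (k : Color) (D : Curve →₀ ℤ) : (E k).Point :=
  D.sum fun p n => n • nu k p

/-- The geometric divisor of a height: the discrete Morse divisor carried to the curve. -/
noncomputable def Embedding.divisor (ε : Embedding) (h : Vertex → ℕ) : Curve →₀ ℤ :=
  (morseDivisor h).mapDomain (Sum.elim ε.vertex ε.center)

end Adinkra

namespace Adinkra

/-! ### Combinatorics of height functions -/

/-! The argument has three layers: combinatorics of heights, explicit coordinates on the curve, and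
a 2-adic argument for infinite order.

Combinatorics. Raising a local minimum `v` by two toggles each of the five faces at `v` between bow
tie and diamond. If `δ_j = ±1` records the toggle of the `(j, j+1)`-face, the coefficient at the
`j`-th neighbour changes by `-(δ_j + δ_{j-1}) / 2`, and no other coefficient changes. Only a few
relations between images of vertices and centres, collected in `MorseRelations`, are needed to push
this forward. Consecutive neighbours have opposite images, except for the pair of colours `k-2,
k-1`, where the images agree. The four ordinary centres give 2-torsion points with sum zero. Hence
the change telescopes to `δ_{k-2}` times one point, which up to sign does not depend on `v`
(`pushSum_raise`, `sub_center`). Every height is connected by such moves to a shifted fully extended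
one (`IsHeight.induction`), whose push-forward vanishes by a character sum
(`pushSum_fullyExtended`). So all images lie in one cyclic group; the single move from `heightOne`
to `heightFE` shows that `heightOne` attains the generator.

Geometry. Over `[u : w]` the squares `x_a²` are proportional to five explicit linear forms with
coefficients in `ℤ[ζ]`. Lifting a path amounts to following square roots of these forms continuously
(`JoinedOver.transport`), and principal square roots suffice on all rays involved. Moving from the
`j`-th to the `(j+1)`-th neighbour then changes only the sign of `x_{j+2}`, and the centre of a `(j,
j+1)`-face is a zero of `x_{j+2}`. The map `ν_k` is negated by a sign change of any coordinate
except `x_k`. It sends zeros of `x_a`, `a ≠ k`, to 2-torsion, and zeros of `x_k` to points whose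
double is a fixed 2-torsion point; that point is also the sum of the images of the two ends of a
`(k-2)`-edge. This gives `MorseRelations`. Conversely, signs attached to the coordinates of a vertex
produce an embedding (`nonempty_embedding`).

Infinite order. The special centre is torsion, so it suffices that points over `0` have images of
infinite order. For a valuation with `v(2) < 1`, the double of such an image has a non-integral
`x`-coordinate, and each further doubling strictly increases its valuation, so the points `2^n P`
are distinct (`not_isOfFinAddOrder_black`). -/

theorem nbr_comm (v : Vertex) (i j : Color) : nbr (nbr v i) j = nbr (nbr v j) i := by
  simp only [nbr]; abel

@[simp] theorem nbr_nbr_self (v : Vertex) (j : Color) : nbr (nbr v j) j = v := by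
  ext i
  simp only [nbr, Pi.add_apply, add_assoc, CharTwo.add_self_eq_zero, add_zero]

theorem nbr_apply_of_ne (v : Vertex) {i j : Color} (h : i ≠ j) : nbr v j i = v i := by
  simp [nbr, h]

theorem nbr_apply_self (v : Vertex) (j : Color) : nbr v j j = v j + 1 := by
  simp [nbr]

theorem nbr_injective (v : Vertex) : Function.Injective (nbr v) := by
  intro i j h
  by_contra hij
  have := congrFun h i
  rw [nbr_apply_self, nbr_apply_of_ne v hij] at this
  simp at this

theorem nbr_ne_self (v : Vertex) (j : Color) : nbr v j ≠ v := by
  intro h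
  have := congrFun h j
  rw [nbr_apply_self] at this
  simp at this

theorem heightFE_nbr_of_ne_zero : ∀ (v : Vertex) (j : Color), v j ≠ 0 →
    heightFE (nbr v j) + 1 = heightFE v := by
  unfold heightFE nbr
  decide +kernel

theorem heightFE_nbr_of_eq_zero (v : Vertex) (j : Color) (h : v j = 0) :
    heightFE (nbr v j) = heightFE v + 1 := by
  have := heightFE_nbr_of_ne_zero (nbr v j) j (by rw [nbr_apply_self, h]; decide)
  rw [nbr_nbr_self] at this
  exact this.symm

/-- The hypercube is connected. -/
theorem vertex_induction {p : Vertex → Prop} (v₀ : Vertex) (h₀ : p v₀)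
    (step : ∀ v j, p v → p (nbr v j)) (v : Vertex) : p v := by
  suffices H : ∀ (n : ℕ) (w : Vertex), heightFE w = n → p (v₀ + w) by
    simpa using H _ (v - v₀) rfl
  intro n
  induction n with
  | zero =>
    intro w hw
    have : w = 0 := by
      simp only [heightFE, Finset.sum_eq_zero_iff, Finset.mem_univ, true_implies,
        ZMod.val_eq_zero] at hw
      exact funext hw
    simpa [this] using h₀
  | succ n ih =>
    intro w hw
    obtain ⟨j, hj⟩ : ∃ j, w j ≠ 0 := by
      by_contra! hc
      rw [show w = 0 from funext hc] at hw
      simp [heightFE] at hw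
    have h1 := heightFE_nbr_of_ne_zero w j hj
    have h2 := step _ j (ih (nbr w j) (by omega))
    have h3 : nbr (v₀ + nbr w j) j = v₀ + w := by
      rw [show v₀ + nbr w j = nbr (v₀ + w) j by simp only [nbr]; abel, nbr_nbr_self]
    rwa [h3] at h2

theorem IsHeight.nbr_eq {h : Vertex → ℕ} (hh : IsHeight h) (v : Vertex) (j : Color) : h (nbr v j) = h v + 1 ∨ h (nbr v j) + 1 = h v := by
  have := hh v j
  rw [abs_eq (by norm_num)] at this
  omega

theorem IsHeight.le_and_parity {h : Vertex → ℕ} (hh : IsHeight h) (v : Vertex) : h v ≤ h 0 + heightFE v ∧ Even (h v + (h 0 + heightFE v)) := by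
  suffices H : ∀ (n : ℕ) (w : Vertex), heightFE w = n →
      h w ≤ h 0 + heightFE w ∧ Even (h w + (h 0 + heightFE w)) from H _ v rfl
  intro n
  induction n with
  | zero =>
    intro w hw
    have : w = 0 := by
      simp only [heightFE, Finset.sum_eq_zero_iff, Finset.mem_univ, true_implies,
        ZMod.val_eq_zero] at hw
      exact funext hw
    rw [hw, this]
    simp
  | succ n ih =>
    intro w hw
    obtain ⟨j, hj⟩ : ∃ j, w j ≠ 0 := by
      by_contra! hc
      rw [show w = 0 from funext hc] at hw
      simp [heightFE] at hw
    have h1 := heightFE_nbr_of_ne_zero w j hj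
    have h2 := ih (nbr w j) (by omega)
    have h3 := hh.nbr_eq w j
    rw [Nat.even_iff] at h2 ⊢
    omega

/-- Raising the height of the single vertex `v` by two. -/
def raise (h : Vertex → ℕ) (v : Vertex) : Vertex → ℕ := fun w => if w = v then h w + 2 else h w

@[simp] theorem raise_self (h : Vertex → ℕ) (v : Vertex) : raise h v v = h v + 2 := by simp [raise]

theorem raise_of_ne (h : Vertex → ℕ) {v w : Vertex} (hw : w ≠ v) : raise h v w = h w := by
  simp [raise, hw]

@[simp] theorem raise_nbr (h : Vertex → ℕ) (v : Vertex) (j : Color) :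
    raise h v (nbr v j) = h (nbr v j) := raise_of_ne h (nbr_ne_self v j)

theorem IsHeight.raise {h : Vertex → ℕ} (hh : IsHeight h) {v : Vertex}
    (hv : ∀ j, h (nbr v j) = h v + 1) : IsHeight (raise h v) := by
  intro w j
  by_cases hw : w = v
  · subst hw
    rw [raise_nbr, raise_self, hv]
    push_cast
    rw [show ((h w : ℤ) + 1 - (h w + 2)) = -1 by ring]
    simp
  · rw [raise_of_ne h hw]
    by_cases hj : nbr w j = v
    · have h1 := hv j
      rw [← hj, nbr_nbr_self] at h1
      rw [hj, raise_self, ← hj, h1]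
      push_cast
      rw [show ((h (nbr w j) : ℤ) + 2 - (h (nbr w j) + 1)) = 1 by ring]
      simp
    · rw [raise_of_ne h hj]
      exact hh w j

/-- Every height can be transformed into a shifted fully extended one by raising local minima. -/
theorem IsHeight.induction {p : (Vertex → ℕ) → Prop}
    (base : ∀ c : ℕ, p fun v => c + heightFE v)
    (step : ∀ h, IsHeight h → ∀ v, (∀ j, h (nbr v j) = h v + 1) → p (Adinkra.raise h v) → p h)
    {h : Vertex → ℕ} (hh : IsHeight h) : p h := by
  -- Induction on the total deficit below `h 0 + heightFE`, the largest height with the given value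
  -- at `0`.
  suffices H : ∀ (n : ℕ) (h : Vertex → ℕ), IsHeight h →
      ∑ v, (h 0 + heightFE v - h v) = n → p h from H _ h hh rfl
  intro n
  induction n using Nat.strong_induction_on with
  | _ n ih =>
    intro h hh hn
    by_cases hd : ∀ v, h v = h 0 + heightFE v
    · rw [show h = fun v => h 0 + heightFE v from funext hd]
      exact base _
    push Not at hd
    -- A deficient vertex of least height is a local minimum: a lower neighbour would not be
    -- deficient, and would then be too high for `v` to be deficient.
    obtain ⟨v, hv, hmin⟩ := Finset.exists_min_image
      (Finset.univ.filter fun v => h v ≠ h 0 + heightFE v) h (by simpa [Finset.Nonempty] using hd)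
    simp only [Finset.mem_filter, Finset.mem_univ, true_and] at hv hmin
    have hvle := hh.le_and_parity v
    rw [Nat.even_iff] at hvle
    have hloc : ∀ j, h (nbr v j) = h v + 1 := by
      intro j
      refine (hh.nbr_eq v j).resolve_right fun hc => ?_
      have h1 : heightFE v ≤ heightFE (nbr v j) + 1 := by
        by_cases hz : v j = 0
        · rw [heightFE_nbr_of_eq_zero v j hz]; omega
        · rw [heightFE_nbr_of_ne_zero v j hz]
      by_cases h2 : h (nbr v j) = h 0 + heightFE (nbr v j)
      · omega
      · have := hmin _ h2
        omega
    refine step h hh v hloc (ih _ ?_ _ (hh.raise hloc) rfl)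
    -- The vertex `0` has no deficit, so it is never raised and the target of the induction stays
    -- fixed.
    have h0 : Adinkra.raise h v 0 = h 0 := by
      refine raise_of_ne h ?_
      rintro rfl
      simp [heightFE] at hv
    rw [h0, ← hn]
    refine Finset.sum_lt_sum (fun w _ => ?_) ⟨v, Finset.mem_univ _, ?_⟩
    · unfold Adinkra.raise
      split_ifs <;> omega
    · rw [raise_self]
      omega

/-! ### The coefficients of the Morse divisor -/

/-- The coefficient of a vertex in the Morse divisor. -/
def vertexCoeff (h : Vertex → ℕ) (v : Vertex) : ℤ :=
  morseCoeff fun j : Color => (h (nbr v j) : ℚ) - h v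

/-- The indicator of the bow ties. -/
def bowTie (h : Vertex → ℕ) (f : Face) : ℤ := if f.IsBowTie h then 1 else 0

theorem signChanges_bool {n : ℕ} [NeZero n] (d : Fin n → ℚ) (u : Fin n → Bool)
    (hd : ∀ i, SignType.sign (d i) = bif u i then 1 else -1) :
    signChanges d = (Finset.univ.filter fun i => u i ≠ u (i + 1)).card := by
  unfold signChanges
  congr 1
  refine Finset.filter_congr fun i _ => ?_
  rw [hd, hd]
  cases u i <;> cases u (i + 1) <;> decide

theorem sign_sub_height {h : Vertex → ℕ} (hh : IsHeight h) (v : Vertex) (j : Color) :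
    SignType.sign ((h (nbr v j) : ℚ) - h v) = bif decide (h v < h (nbr v j)) then 1 else -1 := by
  rcases hh.nbr_eq v j with h1 | h1
  · rw [decide_eq_true (by omega), h1]
    simp
  · rw [decide_eq_false (by omega), ← h1]
    simp

/-- A cyclic sequence of signs changes an even number of times, so the division by two is exact, and
the special value `-1` fits the same formula. -/
theorem two_mul_coeff_bool : ∀ u : Fin 5 → Bool,
    2 * (if (Finset.univ.filter fun i => u i ≠ u (i + 1)).card = 0 then -1 else
      (((Finset.univ.filter fun i => u i ≠ u (i + 1)).card : ℤ) - 2) / 2) =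
      ∑ j, (if u j ≠ u (j + 1) then 1 else 0) - 2 := by
  decide +kernel

/-- The height of `v` itself drops out, since two neighbours lie on the same side of `v` exactly
when they have equal heights. The effect of a raise can thus be read off from neighbours alone. -/
theorem two_mul_vertexCoeff {h : Vertex → ℕ} (hh : IsHeight h) (v : Vertex) :
    2 * vertexCoeff h v =
      ∑ j, (if h (nbr v j) ≠ h (nbr v (j + 1)) then 1 else 0) - 2 := by
  unfold vertexCoeff morseCoeff
  rw [signChanges_bool _ _ (sign_sub_height hh v), two_mul_coeff_bool]
  congr 1
  refine Finset.sum_congr rfl fun j _ => ?_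
  have h1 := hh.nbr_eq v j
  have h2 := hh.nbr_eq v (j + 1)
  congr 1
  simp only [ne_eq, decide_eq_decide, eq_iff_iff]
  omega

theorem face_nbr_left (j : Color) (v : Vertex) : face j (nbr v j) = face j v := by
  refine Subtype.ext (Prod.ext rfl (funext fun i => ?_))
  by_cases hi : i = j
  · simp [face, hi]
  · simp [face, nbr_apply_of_ne v hi]

theorem face_nbr_right (j : Color) (v : Vertex) : face j (nbr v (j + 1)) = face j v := by
  refine Subtype.ext (Prod.ext rfl (funext fun i => ?_))
  by_cases hi : i = j + 1
  · simp [face, hi]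
  · simp [face, nbr_apply_of_ne v hi]

theorem face_of_mem (f : Face) : face f.1.1 f.1.2 = f := by
  obtain ⟨⟨j, v⟩, h1, h2⟩ := f
  refine Subtype.ext (Prod.ext rfl (funext fun i => ?_))
  simp only [face]
  split_ifs with hi
  · rcases hi with rfl | rfl
    · exact h1.symm
    · exact h2.symm
  · rfl

theorem face_cycle (f : Face) (i : Fin 4) : face f.1.1 (f.cycle i) = f := by
  have h0 := face_of_mem f
  fin_cases i
  · exact h0
  · exact (face_nbr_left _ _).trans h0
  · exact (face_nbr_right _ _).trans ((face_nbr_left _ _).trans h0)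
  · exact (face_nbr_right _ _).trans h0

/-- A vertex is the base vertex of its `j`-face up to flipping the coordinates `j` and `j + 1`. -/
theorem base_cases (j : Color) (v : Vertex) :
    v = (face j v).1.2 ∨ v = nbr (face j v).1.2 j ∨ v = nbr (face j v).1.2 (j + 1) ∨
      v = nbr (nbr (face j v).1.2 j) (j + 1) := by
  revert j v
  unfold face nbr
  decide +kernel

/-- Each corner differs by one from its two neighbours, so two values in all means that opposite
corners agree. -/
theorem isBowTie_iff {h : Vertex → ℕ} (hh : IsHeight h) (f : Face) :
    f.IsBowTie h ↔ h (nbr f.1.2 f.1.1) = h (nbr f.1.2 (f.1.1 + 1)) ∧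
      h f.1.2 = h (nbr (nbr f.1.2 f.1.1) (f.1.1 + 1)) := by
  set b := f.1.2 with hb
  set j := f.1.1 with hj
  have h1 := hh.nbr_eq b j
  have h2 := hh.nbr_eq b (j + 1)
  have h3 := hh.nbr_eq (nbr b j) (j + 1)
  have h4 := hh.nbr_eq (nbr b (j + 1)) j
  rw [← nbr_comm] at h4
  have him : (Finset.univ.image fun i => h (f.cycle i)) =
      {h b, h (nbr b j), h (nbr (nbr b j) (j + 1)), h (nbr b (j + 1))} := by
    ext x
    simp [Fin.exists_fin_succ, Face.cycle, hb, hj, eq_comm]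
  unfold Face.IsBowTie
  rw [him]
  generalize h b = x0 at *
  generalize h (nbr b j) = x1 at *
  generalize h (nbr (nbr b j) (j + 1)) = x2 at *
  generalize h (nbr b (j + 1)) = x3 at *
  constructor
  · intro hc
    obtain ⟨a, c, hac, hs⟩ := Finset.card_eq_two.mp hc
    have m0 : x0 ∈ ({a, c} : Finset ℕ) := by rw [← hs]; simp
    have m1 : x1 ∈ ({a, c} : Finset ℕ) := by rw [← hs]; simp
    have m2 : x2 ∈ ({a, c} : Finset ℕ) := by rw [← hs]; simp
    have m3 : x3 ∈ ({a, c} : Finset ℕ) := by rw [← hs]; simp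
    simp only [Finset.mem_insert, Finset.mem_singleton] at m0 m1 m2 m3
    omega
  · rintro ⟨rfl, rfl⟩
    have : x0 ≠ x1 := by omega
    rw [show ({x0, x1, x0, x1} : Finset ℕ) = {x0, x1} by ext; simp]
    exact Finset.card_pair this

theorem face_isBowTie_iff {h : Vertex → ℕ} (hh : IsHeight h) (j : Color) (v : Vertex) :
    (face j v).IsBowTie h ↔ h (nbr v j) = h (nbr v (j + 1)) ∧
      h v = h (nbr (nbr v j) (j + 1)) := by
  rw [isBowTie_iff hh]
  have hj : (face j v).1.1 = j := rfl
  have hb := base_cases j v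
  rw [hj]
  generalize (face j v).1.2 = b at *
  rcases hb with rfl | rfl | rfl | rfl
  · rfl
  · rw [nbr_nbr_self]; constructor <;> rintro ⟨h1, h2⟩ <;> exact ⟨h2, h1⟩
  · rw [nbr_nbr_self, nbr_comm b (j + 1) j, nbr_nbr_self]
    constructor <;> rintro ⟨h1, h2⟩ <;> exact ⟨h2.symm, h1.symm⟩
  · rw [nbr_nbr_self, nbr_comm (nbr b j), nbr_nbr_self, nbr_nbr_self]
    constructor <;> rintro ⟨h1, h2⟩ <;> exact ⟨h1.symm, h2.symm⟩

/-- Around a bow tie the corners lie alternately above and below the average, which gives four sign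
changes and `μ = 1`. -/
theorem faceCoeff_eq {h : Vertex → ℕ} (hh : IsHeight h) (f : Face) :
    morseDivisor h (.inr f) = bowTie h f := by
  change (if f.IsBowTie h then _ else _) = _
  unfold bowTie
  split_ifs with hf
  swap
  · rfl
  obtain ⟨h1, h2⟩ := (isBowTie_iff hh f).mp hf
  have h3 := hh.nbr_eq f.1.2 f.1.1
  have h4 : ∀ i, h (f.cycle i) =
      (![h f.1.2, h (nbr f.1.2 f.1.1), h f.1.2, h (nbr f.1.2 f.1.1)] : Fin 4 → ℕ) i := by
    intro i
    fin_cases i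
    · rfl
    · rfl
    · exact h2.symm
    · exact h1.symm
  simp only [h4]
  generalize h f.1.2 = x at *
  generalize h (nbr f.1.2 f.1.1) = y at *
  unfold morseCoeff
  have hb : ∃ b : Bool, ∀ i : Fin 4, SignType.sign (((![x, y, x, y] : Fin 4 → ℕ) i : ℚ) -
      (∑ l, ((![x, y, x, y] : Fin 4 → ℕ) l : ℚ)) / 4) =
      bif (![b, !b, b, !b] : Fin 4 → Bool) i then 1 else -1 := by
    rw [Fin.sum_univ_four]
    rcases h3 with rfl | rfl
    · refine ⟨false, fun i => ?_⟩
      fin_cases i <;> simp [sign_eq_one_iff, sign_eq_neg_one_iff] <;> linarith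
    · refine ⟨true, fun i => ?_⟩
      fin_cases i <;> simp [sign_eq_one_iff, sign_eq_neg_one_iff] <;> linarith
  obtain ⟨b, hb⟩ := hb
  rw [signChanges_bool _ _ hb]
  cases b <;> decide

theorem morseDivisor_inl (h : Vertex → ℕ) (v : Vertex) :
    morseDivisor h (.inl v) = vertexCoeff h v := rfl

end Adinkra

namespace Adinkra

theorem isHeight_heightFE : IsHeight heightFE := by
  intro v j
  by_cases hz : v j = 0
  · rw [heightFE_nbr_of_eq_zero v j hz]; push_cast; rw [abs_eq (by norm_num)]; left; ring
  · rw [← heightFE_nbr_of_ne_zero v j hz]; push_cast; rw [abs_eq (by norm_num)]; right; ring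

/-! ### The effect of raising a vertex -/

/-- In a face at a local minimum both neighbours of `v` have height `h v + 1`, so the corner
opposite to `v` alone decides: at height `h v` it gives a bow tie before the raise, at `h v + 2` one
after it. -/
theorem bowTie_face_sub {h : Vertex → ℕ} (hh : IsHeight h) {v : Vertex}
    (hv : ∀ j, h (nbr v j) = h v + 1) (j : Color) :
    (bowTie (raise h v) (face j v) - bowTie h (face j v) = 1 ∧
      h (nbr (nbr v j) (j + 1)) = h v + 2) ∨
    (bowTie (raise h v) (face j v) - bowTie h (face j v) = -1 ∧
      h (nbr (nbr v j) (j + 1)) = h v) := by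
  have hne : nbr (nbr v j) (j + 1) ≠ v := by
    intro h1
    have h2 := congrArg (fun w => nbr w (j + 1)) h1
    simp only [nbr_nbr_self] at h2
    have := nbr_injective v h2
    simp at this
  have h1 := hh.nbr_eq (nbr v j) (j + 1)
  have h2 := hv j
  unfold bowTie
  simp only [face_isBowTie_iff hh, face_isBowTie_iff (hh.raise hv), raise_nbr, raise_self,
    raise_of_ne h hne, hv, true_and]
  rcases h1 with h1 | h1
  · left
    rw [if_pos (by omega), if_neg (by omega)]
    omega
  · right
    rw [if_neg (by omega), if_pos (by omega)]
    omega

theorem bowTie_raise_of_ne {h : Vertex → ℕ} {v : Vertex} (f : Face) (hf : ∀ j, face j v ≠ f) :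
    bowTie (raise h v) f = bowTie h f := by
  have hc : ∀ i, raise h v (f.cycle i) = h (f.cycle i) := by
    intro i
    refine raise_of_ne h fun hi => hf f.1.1 ?_
    rw [← hi, face_cycle]
  unfold bowTie Face.IsBowTie
  simp only [hc]

theorem vertexCoeff_raise_of_ne {h : Vertex → ℕ} (hh : IsHeight h) {v : Vertex}
    (hv : ∀ j, h (nbr v j) = h v + 1) (w : Vertex) (hw : ∀ j, nbr v j ≠ w) :
    vertexCoeff (raise h v) w = vertexCoeff h w := by
  have h1 := two_mul_vertexCoeff hh w
  have h2 := two_mul_vertexCoeff (hh.raise hv) w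
  have h3 : ∀ j, raise h v (nbr w j) = h (nbr w j) := by
    intro j
    refine raise_of_ne h fun h4 => hw j ?_
    rw [← h4, nbr_nbr_self]
  simp only [h3] at h2
  omega

/-- Seen from the `j`-th neighbour, `v` lies in direction `j`; only the comparisons of directions
`j, j+1` and `j-1, j` are affected, and each corresponds to one face at `v`. -/
theorem two_mul_vertexCoeff_nbr {h : Vertex → ℕ} (hh : IsHeight h) {v : Vertex}
    (hv : ∀ j, h (nbr v j) = h v + 1) (j : Color) :
    2 * (vertexCoeff (raise h v) (nbr v j) - vertexCoeff h (nbr v j)) =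
      -((bowTie (raise h v) (face j v) - bowTie h (face j v)) +
        (bowTie (raise h v) (face (j - 1) v) - bowTie h (face (j - 1) v))) := by
  rw [mul_sub, two_mul_vertexCoeff hh, two_mul_vertexCoeff (hh.raise hv), sub_sub_sub_cancel_right,
    ← Finset.sum_sub_distrib, Fintype.sum_eq_add j (j - 1) (by grind)]
  · have hne : ∀ i, i ≠ j → nbr (nbr v j) i ≠ v := by
      intro i hi h1
      have h2 := congrArg (fun w => nbr w i) h1
      simp only [nbr_nbr_self] at h2
      exact hi (nbr_injective v h2).symm
    have e1 := bowTie_face_sub hh hv j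
    have e2 := bowTie_face_sub hh hv (j - 1)
    rw [sub_add_cancel] at e2 ⊢
    rw [nbr_comm v (j - 1) j] at e2
    rw [nbr_nbr_self, raise_self, raise_of_ne h (hne (j + 1) (by simp)),
      raise_of_ne h (hne (j - 1) (by simp))]
    split_ifs <;> omega
  · rintro i ⟨h1, h2⟩
    have hne : ∀ i, i ≠ j → nbr (nbr v j) i ≠ v := by
      intro i hi h1
      have h2 := congrArg (fun w => nbr w i) h1
      simp only [nbr_nbr_self] at h2
      exact hi (nbr_injective v h2).symm
    rw [raise_of_ne h (hne i h1), raise_of_ne h (hne (i + 1) (by rintro rfl; simp at h2)), sub_self]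

/-! ### Push-forward of Morse divisors to an abelian group -/

variable {G : Type*} [AddCommGroup G]

/-- The push-forward of the Morse divisor along maps on vertices and on face centres. -/
noncomputable def pushSum (N : Vertex → G) (C : Face → G) (h : Vertex → ℕ) : G :=
  ∑ v, vertexCoeff h v • N v + ∑ f, bowTie h f • C f

/-- The relations between the images of vertices and face centres on the `k`-th elliptic curve. -/
structure MorseRelations (k : Color) (N : Vertex → G) (C : Face → G) : Prop where
  nbr_neg : ∀ v j, j ≠ k - 2 → N (nbr v (j + 1)) = -N (nbr v j)
  nbr_eq : ∀ v, N (nbr v (k - 1)) = N (nbr v (k - 2))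
  torsion : ∃ T : Color → G, (∀ j, j ≠ k - 2 → ∀ v, C (face j v) = T j) ∧
    (∀ j, -T j = T j) ∧ T (k - 1) + T k + T (k + 1) + T (k + 2) = 0
  center_neg : ∀ v j, j ≠ k - 2 →
    C (face (k - 2) (nbr (nbr v j) (j + 1))) = -C (face (k - 2) v)
  add_nbr : ∀ v, N v + N (nbr v (k - 2)) = C (face (k - 2) v) + C (face (k - 2) v)

namespace MorseRelations

variable {k : Color} {N : Vertex → G} {C : Face → G}

theorem pushSum_raise (R : MorseRelations k N C) {h : Vertex → ℕ} (hh : IsHeight h) {v : Vertex}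
    (hv : ∀ j, h (nbr v j) = h v + 1) :
    pushSum N C (raise h v) - pushSum N C h =
      (bowTie (raise h v) (face (k - 2) v) - bowTie h (face (k - 2) v)) •
        (C (face (k - 2) v) - N (nbr v (k - 1))) := by
  have hV : ∑ j, (vertexCoeff (raise h v) (nbr v j) - vertexCoeff h (nbr v j)) • N (nbr v j) =
      ∑ w, (vertexCoeff (raise h v) w - vertexCoeff h w) • N w := by
    refine Fintype.sum_of_injective (nbr v) (nbr_injective v) _ _ (fun w hw => ?_) fun _ => rfl
    rw [vertexCoeff_raise_of_ne hh hv w (fun j hj => hw ⟨j, hj⟩), sub_self, zero_smul]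
  have hF : ∑ j, (bowTie (raise h v) (face j v) - bowTie h (face j v)) • C (face j v) =
      ∑ f, (bowTie (raise h v) f - bowTie h f) • C f := by
    refine Fintype.sum_of_injective (fun j => face j v)
      (fun i j hij => congrArg (fun f : Face => f.1.1) hij) _ _ (fun f hf => ?_) fun _ => rfl
    rw [bowTie_raise_of_ne f (fun j hj => hf ⟨j, hj⟩), sub_self, zero_smul]
  have hS : pushSum N C (raise h v) - pushSum N C h =
      ∑ j, (vertexCoeff (raise h v) (nbr v j) - vertexCoeff h (nbr v j)) • N (nbr v j) +
      ∑ j, (bowTie (raise h v) (face j v) - bowTie h (face j v)) • C (face j v) := by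
    rw [hV, hF]
    simp only [pushSum, sub_smul, Finset.sum_sub_distrib]
    abel
  rw [hS]
  have hd := bowTie_face_sub hh hv
  have ha := two_mul_vertexCoeff_nbr hh hv
  have hn := R.nbr_neg v
  have he := R.nbr_eq v
  obtain ⟨T, hT, hT2, hT0⟩ := R.torsion
  have hC : ∀ j, j ≠ k - 2 →
      (bowTie (raise h v) (face j v) - bowTie h (face j v)) • C (face j v) = T j := by
    intro j hj
    rw [hT j hj]
    rcases hd j with ⟨h1, -⟩ | ⟨h1, -⟩
    · rw [h1, one_smul]
    · rw [h1, neg_one_smul, hT2]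
  clear hS hV hF hT hT2 hd
  generalize hκ : (fun j => vertexCoeff (raise h v) (nbr v j) - vertexCoeff h (nbr v j)) = κ
  generalize hδ : (fun j => bowTie (raise h v) (face j v) - bowTie h (face j v)) = δ at *
  have hκ' : ∀ j, vertexCoeff (raise h v) (nbr v j) - vertexCoeff h (nbr v j) = κ j := congrFun hκ
  have hδ' : ∀ j, bowTie (raise h v) (face j v) - bowTie h (face j v) = δ j := congrFun hδ
  simp only [hκ', hδ'] at ha hC ⊢
  have key : ∀ i : Color, (∑ j, κ j • N (nbr v j) + ∑ j, δ j • C (face j v)) =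
      (κ i • N (nbr v i) + κ (i + 1) • N (nbr v (i + 1)) + κ (i + 2) • N (nbr v (i + 2)) +
        κ (i + 3) • N (nbr v (i + 3)) + κ (i + 4) • N (nbr v (i + 4))) +
      (δ i • C (face i v) + δ (i + 1) • C (face (i + 1) v) + δ (i + 2) • C (face (i + 2) v) +
        δ (i + 3) • C (face (i + 3) v) + δ (i + 4) • C (face (i + 4) v)) := by
    intro i
    rw [← Equiv.sum_comp (Equiv.addLeft i) (fun j => κ j • N (nbr v j)),
      ← Equiv.sum_comp (Equiv.addLeft i) (fun j => δ j • C (face j v)), Fin.sum_univ_five,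
      Fin.sum_univ_five]
    simp
  rw [key (k - 2)]
  -- Indices are counted from the exceptional colour `i = k - 2`.
  obtain ⟨i, rfl⟩ : ∃ i, k = i + 2 := ⟨k - 2, by simp⟩
  have c1 : i + 2 - 2 = i := by simp
  have c2 : i + 2 - 1 = i + 1 := by grind
  have c3 : i + 2 + 1 = i + 3 := by grind
  have c4 : i + 2 + 2 = i + 4 := by grind
  rw [c1] at hn he hC ⊢
  rw [c2] at he ⊢
  rw [c2, c3, c4] at hT0
  have n1 := hn (i + 1) (by simp)
  have n2 := hn (i + 2) (by simp)
  have n3 := hn (i + 3) (by simp)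
  rw [show i + 1 + 1 = i + 2 by grind] at n1
  rw [show i + 2 + 1 = i + 3 by grind] at n2
  rw [show i + 3 + 1 = i + 4 by grind] at n3
  have a0 := ha i
  have a1 := ha (i + 1)
  have a2 := ha (i + 2)
  have a3 := ha (i + 3)
  have a4 := ha (i + 4)
  rw [show i - 1 = i + 4 by grind] at a0
  rw [show i + 1 - 1 = i by simp] at a1
  rw [show i + 2 - 1 = i + 1 by grind] at a2
  rw [show i + 3 - 1 = i + 2 by grind] at a3
  rw [show i + 4 - 1 = i + 3 by grind] at a4
  rw [hC (i + 1) (by simp), hC (i + 2) (by simp), hC (i + 3) (by simp), hC (i + 4) (by simp), n3,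
    n2, n1, ← he]
  -- With `2 κ_j = -(δ_j + δ_{j-1})` the alternating sum telescopes; only `δ_i` survives, because
  -- colours `i` and `i+1` carry the same sign.
  have hκs : κ i + κ (i + 1) - κ (i + 2) + κ (i + 3) - κ (i + 4) = -δ i := by omega
  linear_combination (norm := module) hκs • N (nbr v (i + 1)) + hT0

/-- The sign flips under the exchange of directions `j` and `j+1` exactly when one of these colours
is `k` or `k+2`, that is for `j ≠ k-2`. This matches `nbr_neg` and `nbr_eq`, so the signed image
depends only on the parity of `v`. -/
theorem sign_invariant (R : MorseRelations k N C) (v : Vertex) :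
    (-1 : ℤ) ^ ((v k).val + (v (k + 2)).val) • N v =
      if Even (heightFE v) then N 0 else
        (-1 : ℤ) ^ ((nbr 0 0 k).val + (nbr 0 0 (k + 2)).val) • N (nbr 0 0) := by
  set M : Vertex → G := fun v => (-1 : ℤ) ^ ((v k).val + (v (k + 2)).val) • N v with hM
  have hsgn : ∀ (k : Color) (v : Vertex) (j : Color),
      (-1 : ℤ) ^ ((nbr v (j + 1) k).val + (nbr v (j + 1) (k + 2)).val) =
        if j = k - 2 then (-1 : ℤ) ^ ((nbr v j k).val + (nbr v j (k + 2)).val)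
        else -(-1 : ℤ) ^ ((nbr v j k).val + (nbr v j (k + 2)).val) := by
    have hsgn' : ∀ (k j : Color) (a b : ZMod 2),
      (-1 : ℤ) ^ ((a + (Pi.single (j + 1) 1 : Vertex) k).val +
          (b + (Pi.single (j + 1) 1 : Vertex) (k + 2)).val) =
        if j = k - 2 then (-1 : ℤ) ^ ((a + (Pi.single j 1 : Vertex) k).val +
          (b + (Pi.single j 1 : Vertex) (k + 2)).val)
        else -(-1 : ℤ) ^ ((a + (Pi.single j 1 : Vertex) k).val +
          (b + (Pi.single j 1 : Vertex) (k + 2)).val) := by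
      decide +kernel
    intro k v j
    exact hsgn' k j (v k) (v (k + 2))
  have h1 : ∀ v j, M (nbr v (j + 1)) = M (nbr v j) := by
    intro v j
    simp only [hM]
    rw [hsgn]
    split_ifs with hj
    · subst hj
      rw [← R.nbr_eq, show k - 2 + 1 = k - 1 by grind]
    · rw [R.nbr_neg v j hj, neg_smul, smul_neg, neg_neg]
  have h2 : ∀ v j, M (nbr v j) = M (nbr v 0) := by
    intro v j
    have a1 := h1 v 0
    have a2 := h1 v 1
    have a3 := h1 v 2
    have a4 := h1 v 3
    fin_cases j
    · rfl
    · exact a1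
    · exact a2.trans a1
    · exact a3.trans (a2.trans a1)
    · exact a4.trans (a3.trans (a2.trans a1))
  have hpar : ∀ (v : Vertex) j, Even (heightFE (nbr v j)) ↔ ¬ Even (heightFE v) := by
    intro v j
    by_cases hz : v j = 0
    · rw [heightFE_nbr_of_eq_zero v j hz, Nat.even_add_one]
    · rw [← heightFE_nbr_of_ne_zero v j hz, Nat.even_add_one, not_not]
  have h3 : ∀ v, M v = (if Even (heightFE v) then M 0 else M (nbr 0 0)) ∧
      M (nbr v 0) = (if Even (heightFE (nbr v 0)) then M 0 else M (nbr 0 0)) := by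
    refine vertex_induction 0 ⟨?_, ?_⟩ fun v j hv => ?_
    · rw [if_pos (by decide)]
    · rw [if_neg (by decide)]
    · rw [nbr_comm, h2 (nbr v 0) j, nbr_nbr_self, h2 v j, hv.2]
      simp only [hpar, hv.1]
      simp
  have := (h3 v).1
  simpa [hM] using this

theorem pushSum_fullyExtended (R : MorseRelations k N C) (c : ℕ) :
    pushSum N C (fun v => c + heightFE v) = 0 := by
  have hh : IsHeight fun v => c + heightFE v := by
    intro v j
    simpa using isHeight_heightFE v j
  -- Opposite corners of every face include two whose heights differ by two, so all faces are
  -- diamonds.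
  have hb : ∀ f, bowTie (fun v => c + heightFE v) f = 0 := by
    intro f
    refine if_neg fun hf => ?_
    rw [isBowTie_iff hh] at hf
    have h1 := heightFE_nbr_of_eq_zero _ _ f.2.1
    have h2 := heightFE_nbr_of_eq_zero (nbr f.1.2 f.1.1) (f.1.1 + 1)
      (by rw [nbr_apply_of_ne _ (by simp), f.2.2])
    omega
  set X := N 0
  set Y := (-1 : ℤ) ^ ((nbr 0 0 k).val + (nbr 0 0 (k + 2)).val) • N (nbr 0 0) with hY
  have hN : ∀ v, N v = (-1 : ℤ) ^ ((v k).val + (v (k + 2)).val) •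
      (if Even (heightFE v) then X else Y) := by
    intro v
    rw [← R.sign_invariant v, smul_smul, ← mul_pow]
    simp
  have hκ : ∀ v, 2 * vertexCoeff (fun v => c + heightFE v) v =
      ∑ j, (if v j ≠ v (j + 1) then 1 else 0) - 2 := by
    intro v
    rw [two_mul_vertexCoeff hh]
    congr 1
    refine Finset.sum_congr rfl fun j _ => ?_
    congr 1
    simp only [ne_eq, eq_iff_iff, add_right_inj]
    rw [not_iff_not]
    have hz : ∀ a : ZMod 2, a ≠ 0 → a = 1 := by decide
    by_cases h1 : v j = 0 <;> by_cases h2 : v (j + 1) = 0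
    · rw [heightFE_nbr_of_eq_zero v j h1, heightFE_nbr_of_eq_zero v _ h2, h1, h2]; simp
    · have := heightFE_nbr_of_ne_zero v _ h2
      rw [heightFE_nbr_of_eq_zero v j h1, h1, hz _ h2]; simp; omega
    · have := heightFE_nbr_of_ne_zero v _ h1
      rw [heightFE_nbr_of_eq_zero v _ h2, h2, hz _ h1]; simp; omega
    · have := heightFE_nbr_of_ne_zero v _ h1
      have := heightFE_nbr_of_ne_zero v _ h2
      rw [hz _ h1, hz _ h2]; simp; omega
  -- Orthogonality of characters: twice the coefficient is a combination of the trivial character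
  -- and those of adjacent pairs `{j, j+1}`. The character of `{k, k+2}` and its product with the
  -- parity character, that of the three remaining colours, are both orthogonal to these.
  have hdec : ∀ (k : Color) (b : Bool), ∑ v : Vertex, (if decide (Even (heightFE v)) = b then
      (∑ j, (if v j ≠ v (j + 1) then 1 else 0) - 2) * (-1 : ℤ) ^ ((v k).val + (v (k + 2)).val)
      else 0) = 0 := by
    unfold heightFE
    decide +kernel
  have hsum : ∀ b : Bool, ∑ v : Vertex, (if decide (Even (heightFE v)) = b then
      vertexCoeff (fun v => c + heightFE v) v * (-1 : ℤ) ^ ((v k).val + (v (k + 2)).val)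
      else 0) = 0 := by
    intro b
    have h2 := hdec k b
    simp only [← hκ, mul_assoc, ← mul_ite_zero, ← Finset.mul_sum] at h2
    simpa using h2
  unfold pushSum
  simp only [hb, zero_smul, Finset.sum_const_zero, add_zero]
  have hsplit : ∑ v, vertexCoeff (fun v => c + heightFE v) v • N v =
      (∑ v : Vertex, (if decide (Even (heightFE v)) = true then
        vertexCoeff (fun v => c + heightFE v) v * (-1 : ℤ) ^ ((v k).val + (v (k + 2)).val)
        else 0)) • X +
      (∑ v : Vertex, (if decide (Even (heightFE v)) = false then
        vertexCoeff (fun v => c + heightFE v) v * (-1 : ℤ) ^ ((v k).val + (v (k + 2)).val)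
        else 0)) • Y := by
    rw [Finset.sum_smul, Finset.sum_smul, ← Finset.sum_add_distrib]
    refine Finset.sum_congr rfl fun v _ => ?_
    rw [hN v, smul_smul]
    by_cases hv : Even (heightFE v) <;> simp [hv]
  rw [hsplit, hsum, hsum, zero_smul, zero_smul, add_zero]

theorem sub_center_nbr_left (R : MorseRelations k N C) (v : Vertex) :
    N (nbr v (k - 2)) - C (face (k - 2) (nbr v (k - 2))) = -(N v - C (face (k - 2) v)) := by
  rw [face_nbr_left, eq_sub_of_add_eq' (R.add_nbr v)]
  abel

theorem sub_center_nbr_right (R : MorseRelations k N C) (v : Vertex) :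
    N (nbr v (k - 1)) - C (face (k - 2) (nbr v (k - 1))) = -(N v - C (face (k - 2) v)) := by
  rw [← R.sub_center_nbr_left, R.nbr_eq, face_nbr_left,
    show k - 1 = k - 2 + 1 by grind, face_nbr_right]

theorem sub_center_nbr_nbr (R : MorseRelations k N C) (v : Vertex) {j : Color} (hj : j ≠ k - 2) :
    N (nbr (nbr v j) (j + 1)) - C (face (k - 2) (nbr (nbr v j) (j + 1))) =
      -(N v - C (face (k - 2) v)) := by
  rw [R.center_neg v j hj, R.nbr_neg _ j hj, nbr_nbr_self]
  abel

theorem sub_center_nbr (R : MorseRelations k N C) (v : Vertex) (j : Color) :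
    N (nbr v j) - C (face (k - 2) (nbr v j)) = N v - C (face (k - 2) v) ∨
      N (nbr v j) - C (face (k - 2) (nbr v j)) = -(N v - C (face (k - 2) v)) := by
  have step : ∀ {j}, j ≠ k - 2 → ∀ v,
      N (nbr v (j + 1)) - C (face (k - 2) (nbr v (j + 1))) =
      -(N (nbr v j) - C (face (k - 2) (nbr v j))) := by
    intro j hj v
    have := R.sub_center_nbr_nbr (nbr v j) hj
    rwa [nbr_nbr_self] at this
  have e0 := R.sub_center_nbr_right v
  have e1 := step (j := k - 1) (by simp) v
  have e2 := step (j := k) (by grind) v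
  have e3 := step (j := k + 1) (by grind) v
  rw [sub_add_cancel] at e1
  rw [show k + 1 + 1 = k + 2 by grind] at e3
  have hj : j = k - 2 ∨ j = k - 1 ∨ j = k ∨ j = k + 1 ∨ j = k + 2 := by grind
  rcases hj with rfl | rfl | rfl | rfl | rfl
  · exact .inr (R.sub_center_nbr_left v)
  · exact .inr e0
  · rw [e1, e0, neg_neg]; exact .inl rfl
  · rw [e2, e1, e0, neg_neg]; exact .inr rfl
  · rw [e3, e2, e1, e0, neg_neg, neg_neg]; exact .inl rfl

/-- The hypercube is connected and each edge preserves this difference up to sign, so all raises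
contribute multiples of one point. -/
theorem sub_center (R : MorseRelations k N C) (v : Vertex) :
    N v - C (face (k - 2) v) = N 1 - C (face (k - 2) 1) ∨
      N v - C (face (k - 2) v) = -(N 1 - C (face (k - 2) 1)) := by
  refine vertex_induction (p := fun v => N v - C (face (k - 2) v) = N 1 - C (face (k - 2) 1) ∨
      N v - C (face (k - 2) v) = -(N 1 - C (face (k - 2) 1))) 1 (.inl rfl) (fun v j hv => ?_) v
  rcases R.sub_center_nbr v j with h1 | h1 <;> rw [h1]
  · exact hv
  · rcases hv with h2 | h2 <;> rw [h2]
    · exact .inr rfl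
    · exact .inl (neg_neg _)

theorem center_sub_nbr (R : MorseRelations k N C) (v : Vertex) :
    C (face (k - 2) v) - N (nbr v (k - 1)) = N v - C (face (k - 2) v) := by
  have h1 := R.sub_center_nbr_right v
  rw [show face (k - 2) (nbr v (k - 1)) = face (k - 2) v by
    rw [show k - 1 = k - 2 + 1 by grind, face_nbr_right]] at h1
  rw [← neg_sub, h1, neg_neg]

theorem pushSum_mem (R : MorseRelations k N C) {h : Vertex → ℕ} (hh : IsHeight h) :
    pushSum N C h ∈ AddSubgroup.zmultiples (N 1 - C (face (k - 2) 1)) := by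
  refine IsHeight.induction (p := fun h => pushSum N C h ∈ _) (fun c => ?_)
    (fun h hh v hv hr => ?_) hh
  · rw [R.pushSum_fullyExtended]
    exact zero_mem _
  · have h1 := R.pushSum_raise hh hv
    rw [R.center_sub_nbr] at h1
    rw [← sub_sub_cancel (pushSum N C (raise h v)) (pushSum N C h), h1]
    refine sub_mem hr (AddSubgroup.zsmul_mem _ ?_ _)
    rcases R.sub_center v with h2 | h2 <;> rw [h2]
    · exact AddSubgroup.mem_zmultiples _
    · exact neg_mem (AddSubgroup.mem_zmultiples _)

end MorseRelations

/-! ### The height with lowered top vertex -/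

theorem raise_heightOne : raise heightOne 1 = heightFE := by
  funext v
  unfold raise heightOne
  split_ifs with hv
  · subst hv
    decide
  · rfl

theorem isHeight_heightOne : IsHeight heightOne := by
  unfold IsHeight heightOne heightFE nbr
  decide +kernel

namespace MorseRelations

variable {k : Color} {N : Vertex → G} {C : Face → G}

theorem pushSum_heightOne (R : MorseRelations k N C) :
    pushSum N C heightOne = N 1 - C (face (k - 2) 1) := by
  have hv : ∀ j, heightOne (nbr 1 j) = heightOne 1 + 1 := by
    unfold heightOne heightFE nbr
    decide +kernel
  have h1 := R.pushSum_raise isHeight_heightOne hv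
  have h2 := R.pushSum_fullyExtended 0
  simp only [zero_add] at h2
  -- Both vertices have height three, so every face at the top is a bow tie before the raise and `δ
  -- = -1`.
  have h3 : ∀ j : Color, heightOne (nbr (nbr 1 j) (j + 1)) = heightOne 1 := by
    unfold heightOne heightFE nbr
    decide +kernel
  have h4 : bowTie (raise heightOne 1) (face (k - 2) 1) - bowTie heightOne (face (k - 2) 1) =
      -1 := by
    rcases bowTie_face_sub isHeight_heightOne hv (k - 2) with h | h
    · rw [h3] at h; omega
    · exact h.1
  rw [h4, raise_heightOne, show heightFE = fun v => heightFE v from rfl, h2, R.center_sub_nbr,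
    zero_sub, neg_one_smul, neg_inj] at h1
  exact h1

end MorseRelations

end Adinkra

namespace Adinkra

/-! ### The tenth root of unity and the golden ratio -/

theorem isPrimitiveRoot_zeta : IsPrimitiveRoot zeta 10 := by
  have := Complex.isPrimitiveRoot_exp 10 (by norm_num)
  unfold zeta
  exact_mod_cast this

theorem zeta_ne_zero : zeta ≠ 0 := Complex.exp_ne_zero _

theorem zeta_pow_ten : zeta ^ 10 = 1 := isPrimitiveRoot_zeta.pow_eq_one

theorem zeta_pow_five : zeta ^ 5 = -1 := by
  have h : (zeta ^ 5) ^ 2 = 1 := by rw [← pow_mul]; exact zeta_pow_ten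
  rcases mul_self_eq_one_iff.mp ((sq _).symm.trans h) with h | h
  · exact absurd h (isPrimitiveRoot_zeta.pow_ne_one_of_pos_of_lt (by norm_num) (by norm_num))
  · exact h

theorem zeta_pow_four : zeta ^ 4 = zeta ^ 3 - zeta ^ 2 + zeta - 1 := by
  have h1 : zeta + 1 ≠ 0 := by
    intro h
    have h2 : zeta = -1 := by linear_combination h
    have := isPrimitiveRoot_zeta.pow_ne_one_of_pos_of_lt (l := 2) (by norm_num) (by norm_num)
    rw [h2] at this
    norm_num at this
  refine mul_left_cancel₀ h1 ?_
  linear_combination zeta_pow_five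

theorem zeta_inv : zeta⁻¹ = -zeta ^ 4 := by
  refine inv_eq_of_mul_eq_one_right ?_
  linear_combination -zeta_pow_five

/-- Since `φ = 2 cos (π / 5) = ζ + ζ⁻¹`, all later identities take place in `ℤ[ζ]` or with
denominator `5`, apart from square roots, and reduce to `zeta_pow_four`. -/
theorem phi_eq : phi = 1 + zeta ^ 2 - zeta ^ 3 := by
  have h : phi = zeta + zeta⁻¹ := by
    have hz : zeta = Complex.exp (((Real.pi / 5 : ℝ) : ℂ) * Complex.I) := by
      unfold zeta; congr 1; push_cast; ring
    rw [hz, ← Complex.exp_neg, ← neg_mul, ← Complex.two_cos, ← Complex.ofReal_cos,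
      Real.cos_pi_div_five]
    unfold phi Real.goldenRatio
    push_cast
    ring
  rw [h, zeta_inv]
  linear_combination -zeta_pow_four

/-! ### Group law on the curves -/

theorem E_equation_iff (k : Color) (x y : ℂ) :
    (E k).Equation x y ↔ y ^ 2 = x * (x - 1) * (x - root k) := by
  rw [WeierstrassCurve.Affine.equation_iff]
  simp only [E]
  constructor <;> intro h <;> linear_combination h

theorem E_nonsingular {k : Color} {x y : ℂ} (h : y ^ 2 = x * (x - 1) * (x - root k)) :
    (E k).Nonsingular x y :=
  (WeierstrassCurve.Affine.equation_iff_nonsingular_of_Δ_ne_zero (E_disc_ne k)).mp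
    ((E_equation_iff k x y).mpr h)

theorem E_sq_of_nonsingular {k : Color} {x y : ℂ} (h : (E k).Nonsingular x y) :
    y ^ 2 = x * (x - 1) * (x - root k) :=
  (E_equation_iff k x y).mp h.1

theorem some_congr {k : Color} {x y x' y' : ℂ} {h : (E k).Nonsingular x y}
    {h' : (E k).Nonsingular x' y'} (hx : x = x') (hy : y = y') :
    (WeierstrassCurve.Affine.Point.some x y h : (E k).Point) = .some x' y' h' := by
  subst hx hy
  rfl

theorem neg_some_eq {k : Color} {x y x' y' : ℂ} {h : (E k).Nonsingular x y}
    {h' : (E k).Nonsingular x' y'} (hx : x = x') (hy : y' = -y) :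
    -(WeierstrassCurve.Affine.Point.some x y h : (E k).Point) = .some x' y' h' := by
  rw [WeierstrassCurve.Affine.Point.neg_some]
  refine some_congr hx ?_
  simp only [WeierstrassCurve.Affine.negY, E, hy]
  ring

/-- `hX` is the addition formula for the `x`-coordinate, and `hY` says that the chord passes through
`(t, 0)`. This third intersection point is its own negative, hence it is the sum. -/
theorem add_eq_of_collinear {k : Color} {x₁ y₁ x₂ y₂ t : ℂ} {h₁ : (E k).Nonsingular x₁ y₁}
    {h₂ : (E k).Nonsingular x₂ y₂} {ht : (E k).Nonsingular t 0} (hx : x₁ ≠ x₂)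
    (hX : (y₁ - y₂) ^ 2 = (t - (1 + root k) + x₁ + x₂) * (x₁ - x₂) ^ 2)
    (hY : (y₁ - y₂) * (t - x₁) + y₁ * (x₁ - x₂) = 0) :
    (WeierstrassCurve.Affine.Point.some x₁ y₁ h₁ : (E k).Point) + .some x₂ y₂ h₂ =
      .some t 0 ht := by
  have hx' := sub_ne_zero.mpr hx
  rw [WeierstrassCurve.Affine.Point.add_of_X_ne hx]
  have hadd : (E k).addX x₁ x₂ ((E k).slope x₁ x₂ y₁ y₂) = t := by
    rw [WeierstrassCurve.Affine.slope_of_X_ne hx]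
    simp only [WeierstrassCurve.Affine.addX, E]
    field_simp
    linear_combination hX
  refine some_congr hadd ?_
  simp only [WeierstrassCurve.Affine.addY, WeierstrassCurve.Affine.negAddY, hadd]
  rw [WeierstrassCurve.Affine.slope_of_X_ne hx]
  simp only [WeierstrassCurve.Affine.negY, E]
  field_simp
  linear_combination -hY

theorem addX_self {k : Color} {x y : ℂ} (h : (E k).Nonsingular x y) (hy : y ≠ 0) :
    (E k).addX x x ((E k).slope x x y y) * (4 * y ^ 2) = (x ^ 2 - root k) ^ 2 := by
  have hy' : y ≠ (E k).negY x y := by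
    simp only [WeierstrassCurve.Affine.negY, E]
    intro h
    apply hy
    linear_combination h / 2
  have h2 : y - -y ≠ 0 := by
    intro h; apply hy; linear_combination h / 2
  rw [WeierstrassCurve.Affine.slope_of_Y_ne rfl hy']
  simp only [WeierstrassCurve.Affine.negY, WeierstrassCurve.Affine.addX, E, zero_mul, sub_zero]
  have hsq := E_sq_of_nonsingular h
  rw [show y - -y = 2 * y by ring]
  field_simp
  linear_combination (16 * (1 + root k) - 32 * x) * hsq

theorem add_self_some {k : Color} {x y : ℂ} (h : (E k).Nonsingular x y) (hy : y ≠ 0) :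
    ∃ y' h', (WeierstrassCurve.Affine.Point.some x y h : (E k).Point) + .some x y h =
      .some ((x ^ 2 - root k) ^ 2 / (4 * y ^ 2)) y' h' := by
  have hy' : y ≠ (E k).negY x y := by
    simp only [WeierstrassCurve.Affine.negY, E]
    intro h
    apply hy
    linear_combination h / 2
  have hX := addX_self h hy
  rw [← eq_div_iff (mul_ne_zero (by norm_num) (pow_ne_zero 2 hy))] at hX
  rw [WeierstrassCurve.Affine.Point.add_self_of_Y_ne hy', ← hX]
  exact ⟨_, _, rfl⟩

theorem add_self_eq_two_torsion {k : Color} {x y t : ℂ} {h : (E k).Nonsingular x y}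
    {ht : (E k).Nonsingular t 0} (hy : y ≠ 0) (hX : (x ^ 2 - root k) ^ 2 = t * (4 * y ^ 2)) :
    (WeierstrassCurve.Affine.Point.some x y h : (E k).Point) + .some x y h = .some t 0 ht := by
  obtain ⟨y', h', he⟩ := add_self_some h hy
  rw [he]
  have hx : (x ^ 2 - root k) ^ 2 / (4 * y ^ 2) = t := by
    rw [hX, mul_div_cancel_right₀ _ (mul_ne_zero (by norm_num) (pow_ne_zero 2 hy))]
  refine some_congr hx ?_
  have h1 := E_sq_of_nonsingular h'
  rw [hx, ← E_sq_of_nonsingular ht] at h1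
  simpa using h1

theorem add_two_torsion {k : Color} {s t u : ℂ} {hs : (E k).Nonsingular s 0}
    {ht : (E k).Nonsingular t 0} {hu : (E k).Nonsingular u 0} (hst : s ≠ t)
    (h : s + t + u = 1 + root k) :
    (WeierstrassCurve.Affine.Point.some s 0 hs : (E k).Point) + .some t 0 ht + .some u 0 hu =
      0 := by
  rw [add_eq_of_collinear (t := u) (ht := hu) hst (by linear_combination -(s - t) ^ 2 * h) (by ring),
    ← sub_neg_eq_add, neg_some_eq (h' := hu) rfl (by simp), sub_self]

/-! ### Points of infinite order -/

/-- The ideal `(2)` of `ℤ` is proper, hence is dominated by a valuation ring of `ℂ`. This serves as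
a 2-adic place without descending to a number field. -/
theorem exists_valuationSubring_two : ∃ A : ValuationSubring ℂ, A.valuation 2 < 1 := by
  let R : Subring ℂ := (Int.castRingHom ℂ).range
  let I : Ideal R := Ideal.span {2}
  have hI : I ≠ ⊤ := by
    rw [Ne, Ideal.span_singleton_eq_top, isUnit_iff_exists_inv]
    rintro ⟨⟨b, ⟨n, hn⟩⟩, hb⟩
    have h1 : (2 : ℂ) * b = 1 := congrArg Subtype.val hb
    rw [← hn] at h1
    have h2 : (2 : ℤ) * n = 1 := by
      rw [eq_intCast] at h1
      exact_mod_cast h1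
    omega
  obtain ⟨A, -, hA⟩ := Ideal.image_subset_nonunits_valuationSubring I hI
  have h2 : (2 : ℂ) ∈ A.nonunits := hA ⟨2, Ideal.subset_span rfl, rfl⟩
  exact ⟨A, h2⟩

section Valuation

variable {A : ValuationSubring ℂ}

theorem zeta_mem : zeta ∈ A := by
  rw [← A.valuation_le_one_iff]
  have h : A.valuation zeta ^ 10 = 1 := by rw [← map_pow, zeta_pow_ten, map_one]
  exact (pow_le_one_iff (by norm_num)).mp h.le

theorem root_mem (k : Color) : root k ∈ A := by
  have hz : zeta ∈ A := zeta_mem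
  have hp : phi ∈ A := by
    rw [phi_eq]
    exact sub_mem (add_mem A.one_mem (pow_mem hz 2)) (pow_mem hz 3)
  fin_cases k
  · exact hp
  · exact add_mem hp A.one_mem
  · exact hp
  · exact neg_mem hp
  · exact add_mem hp A.one_mem

theorem valuation_double (hA : A.valuation 2 < 1) {k : Color} {x y : ℂ}
    (h : (E k).Nonsingular x y) (hx : 1 < A.valuation x) :
    ∃ x' y' h', (WeierstrassCurve.Affine.Point.some x y h : (E k).Point) + .some x y h =
      .some x' y' h' ∧ A.valuation x < A.valuation x' := by
  set v := A.valuation with hv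
  have hr : v (root k) ≤ 1 := (A.valuation_le_one_iff _).mpr (root_mem k)
  have h1 : v (x - 1) = v x := Valuation.map_sub_eq_of_lt_left v (by rwa [map_one])
  have h2 : v (x - root k) = v x := Valuation.map_sub_eq_of_lt_left v (hr.trans_lt hx)
  have h3 : v (x ^ 2 - root k) = v x ^ 2 := by
    rw [Valuation.map_sub_eq_of_lt_left v, map_pow]
    rw [map_pow]
    exact hr.trans_lt (one_lt_pow₀ hx (by norm_num))
  have hsq : v y ^ 2 = v x ^ 3 := by
    rw [← map_pow, E_sq_of_nonsingular h, map_mul, map_mul, h1, h2, pow_succ, sq]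
  have hx0 : v x ≠ 0 := (zero_lt_one.trans hx).ne'
  have hy : y ≠ 0 := by
    rintro rfl
    rw [map_zero, zero_pow (by norm_num)] at hsq
    exact pow_ne_zero 3 hx0 hsq.symm
  obtain ⟨y', h', he⟩ := add_self_some h hy
  refine ⟨_, y', h', he, ?_⟩
  have h20 : v 2 ≠ 0 := (Valuation.ne_zero_iff v).mpr two_ne_zero
  have h4 : v 4 = v 2 ^ 2 := by rw [← map_pow]; norm_num
  -- The numerator has valuation `v(x)^4` and the denominator `v(2)^2 v(x)^3`, so doubling divides
  -- `v(x)` by `v(2)^2 < 1`.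
  have key : v ((x ^ 2 - root k) ^ 2 / (4 * y ^ 2)) * v 2 ^ 2 = v x := by
    rw [map_div₀, map_mul, map_pow, map_pow, h3, hsq, h4]
    field_simp
  rw [← key]
  have h5 : v 2 ^ 2 < 1 := pow_lt_one₀ zero_le hA (by norm_num)
  have h6 : v ((x ^ 2 - root k) ^ 2 / (4 * y ^ 2)) ≠ 0 := by
    intro h0
    rw [h0, zero_mul] at key
    exact hx0 key.symm
  exact mul_lt_of_lt_one_right (zero_lt_iff.mpr h6) h5

theorem not_isOfFinAddOrder_of_valuation (hA : A.valuation 2 < 1) {k : Color} {x y : ℂ}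
    (h : (E k).Nonsingular x y) (hx : 1 < A.valuation x) :
    ¬ IsOfFinAddOrder (WeierstrassCurve.Affine.Point.some x y h : (E k).Point) := by
  set P : (E k).Point := .some x y h with hP
  have step : ∀ n : ℕ, ∀ x₁ y₁ h₁, (2 ^ n • P : (E k).Point) = .some x₁ y₁ h₁ →
      1 < A.valuation x₁ → ∀ m, ∃ x₂ y₂ h₂, (2 ^ (n + m + 1) • P : (E k).Point) =
        .some x₂ y₂ h₂ ∧ A.valuation x₁ < A.valuation x₂ := by
    intro n x₁ y₁ h₁ he hv m
    induction m with
    | zero =>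
      obtain ⟨x', y', h', e, hlt⟩ := valuation_double hA h₁ hv
      refine ⟨x', y', h', ?_, hlt⟩
      rw [add_zero, pow_succ, mul_nsmul, two_nsmul, he, e]
    | succ m ih =>
      obtain ⟨x₂, y₂, h₂, e₂, hlt₂⟩ := ih
      obtain ⟨x', y', h', e, hlt⟩ := valuation_double hA h₂ (hv.trans hlt₂)
      refine ⟨x', y', h', ?_, hlt₂.trans hlt⟩
      rw [show n + (m + 1) + 1 = (n + m + 1) + 1 by ring, pow_succ, mul_nsmul,
        two_nsmul, e₂, e]
  have hex : ∀ n : ℕ, ∃ x₁ y₁ h₁, (2 ^ n • P : (E k).Point) = .some x₁ y₁ h₁ ∧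
      1 < A.valuation x₁ := by
    intro n
    cases n with
    | zero => exact ⟨x, y, h, by rw [pow_zero, one_nsmul], hx⟩
    | succ n =>
      obtain ⟨x₂, y₂, h₂, e, hlt⟩ := step 0 x y h (by rw [pow_zero, one_nsmul]) hx n
      rw [zero_add] at e
      exact ⟨x₂, y₂, h₂, e, hx.trans hlt⟩
  have hinj : Function.Injective fun n : ℕ => (2 ^ n • P : (E k).Point) := by
    refine Function.Injective.of_lt_imp_ne fun m n hmn heq => ?_
    obtain ⟨x₁, y₁, h₁, e₁, hv₁⟩ := hex m
    obtain ⟨d, rfl⟩ := Nat.exists_eq_add_of_lt hmn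
    obtain ⟨x₂, y₂, h₂, e₂, hlt⟩ := step m x₁ y₁ h₁ e₁ hv₁ d
    rw [e₁, e₂] at heq
    simp only [WeierstrassCurve.Affine.Point.some.injEq] at heq
    exact hlt.ne (by rw [heq.1])
  intro hfin
  refine Set.infinite_range_of_injective hinj (hfin.finite_multiples.subset ?_)
  rintro _ ⟨n, rfl⟩
  exact ⟨2 ^ n, rfl⟩

end Valuation

end Adinkra

namespace Adinkra

/-! ### Homogeneous coordinates of points of the curve -/

/-- `x` is a vector of homogeneous coordinates of the point `p` of the curve. -/
def Represents (x : Color → ℂ) (p : Curve) : Prop := ∃ hx : x ≠ 0, p.1 = Projectivization.mk ℂ x hx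

theorem Represents.ne_zero {x : Color → ℂ} {p : Curve} (h : Represents x p) : x ≠ 0 := h.1

theorem Represents.exists_rep {x : Color → ℂ} {p : Curve} (h : Represents x p) :
    ∃ c : ℂ, c ≠ 0 ∧ p.1.rep = c • x := by
  obtain ⟨hx, hp⟩ := h
  have h1 : Projectivization.mk ℂ p.1.rep p.1.rep_nonzero = Projectivization.mk ℂ x hx := by
    rw [Projectivization.mk_rep, hp]
  obtain ⟨c, hc⟩ := (Projectivization.mk_eq_mk_iff ℂ _ _ _ _).mp h1
  exact ⟨c, c.ne_zero, hc.symm⟩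

theorem Represents.smul {x : Color → ℂ} {p : Curve} (h : Represents x p) {c : ℂ} (hc : c ≠ 0) :
    Represents (c • x) p := by
  obtain ⟨hx, hp⟩ := h
  refine ⟨smul_ne_zero hc hx, hp.trans ?_⟩
  rw [Projectivization.mk_eq_mk_iff' ]
  exact ⟨c⁻¹, inv_smul_smul₀ hc x⟩

theorem Represents.exists_smul {x y : Color → ℂ} {p : Curve} (hx : Represents x p)
    (hy : Represents y p) : ∃ c : ℂ, c ≠ 0 ∧ y = c • x := by
  obtain ⟨hx, hp⟩ := hx
  obtain ⟨hy, hp'⟩ := hy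
  obtain ⟨c, hc⟩ := (Projectivization.mk_eq_mk_iff ℂ _ _ _ _).mp (hp'.symm.trans hp)
  exact ⟨c, c.ne_zero, hc.symm⟩

theorem Represents.onCurve {x : Color → ℂ} {p : Curve} (h : Represents x p) : OnCurve x := by
  obtain ⟨c, hc, hr⟩ := h.exists_rep
  have : x = c⁻¹ • p.1.rep := by rw [hr, inv_smul_smul₀ hc]
  rw [this]
  exact onCurve_smul p.2 _

theorem nuX_smul (k : Color) (x : Color → ℂ) {c : ℂ} (hc : c ≠ 0) :
    nuX k (c • x) = nuX k x := by
  fin_cases k <;> simp only [nuX, Pi.smul_apply, smul_eq_mul, mul_pow,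
    mul_div_mul_left _ _ (pow_ne_zero 2 hc)]

theorem nuY_smul (k : Color) (x : Color → ℂ) {c : ℂ} (hc : c ≠ 0) :
    nuY k (c • x) = nuY k x := by
  have h : ∀ a b d e : ℂ, c * a * (c * b) * (c * d) / (c * e) ^ 3 = a * b * d / e ^ 3 := by
    intro a b d e
    rw [show c * a * (c * b) * (c * d) = c ^ 3 * (a * b * d) by ring, mul_pow,
      mul_div_mul_left _ _ (pow_ne_zero 3 hc)]
  fin_cases k <;> simp only [nuY, Pi.smul_apply, smul_eq_mul, h]

theorem nu_eq_zero {k : Color} {p : Curve} {x : Color → ℂ} (hx : Represents x p)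
    (hk : x (k - 1) = 0) : nu k p = 0 := by
  obtain ⟨c, hc, hr⟩ := hx.exists_rep
  exact dif_pos (by rw [hr]; simp [hk])

theorem nu_nonsingular {k : Color} {x : Color → ℂ} (hx : OnCurve x) (hk : x (k - 1) ≠ 0) :
    (E k).Nonsingular (nuX k x) (nuY k x) :=
  (WeierstrassCurve.Affine.equation_iff_nonsingular_of_Δ_ne_zero (E_disc_ne k)).mp
    (nu_equation k x hx hk)

theorem nu_eq_some {k : Color} {p : Curve} {x : Color → ℂ} (hx : Represents x p)
    (hk : x (k - 1) ≠ 0) :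
    nu k p = .some (nuX k x) (nuY k x) (nu_nonsingular hx.onCurve hk) := by
  obtain ⟨c, hc, hr⟩ := hx.exists_rep
  unfold nu
  rw [dif_neg (by rw [hr]; simp [hk, hc])]
  exact some_congr (by rw [hr, nuX_smul k x hc]) (by rw [hr, nuY_smul k x hc])

/-- The points `p` and `q` differ by the sign of the coordinate `b`. -/
def Flipped (b : Color) (p q : Curve) : Prop :=
  ∃ x y, Represents x p ∧ Represents y q ∧ ∀ a, y a = if a = b then -x a else x a

/-- `nuX` involves only squares, while `nuY` contains every coordinate except `x_k` to an odd power.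
-/
theorem Flipped.nu_eq {b : Color} {p q : Curve} (h : Flipped b p q) (k : Color) :
    nu k q = if b = k then nu k p else -nu k p := by
  obtain ⟨x, y, hx, hy, hxy⟩ := h
  by_cases hk : x (k - 1) = 0
  · have hk' : y (k - 1) = 0 := by rw [hxy, hk]; simp
    rw [nu_eq_zero hx hk, nu_eq_zero hy hk']
    simp
  have hk' : y (k - 1) ≠ 0 := by rw [hxy]; split_ifs <;> simpa using hk
  rw [nu_eq_some hx hk, nu_eq_some hy hk']
  have hsq : ∀ a, y a ^ 2 = x a ^ 2 := by
    intro a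
    rw [hxy]
    split_ifs <;> ring
  have hX : nuX k y = nuX k x := by fin_cases k <;> simp only [nuX, hsq]
  split_ifs with hb
  · subst hb
    refine some_congr hX ?_
    fin_cases b <;> simp [nuY, hxy]
  · symm
    refine neg_some_eq hX.symm ?_
    fin_cases k <;> fin_cases b <;> first
      | exact absurd rfl hb
      | simp [nuY, hxy, neg_div, div_neg, Odd.neg_pow (n := 3) (by decide)]

/-! ### Points over the branch points -/

theorem phi_ne_one : phi ≠ 1 := by
  intro h
  have := phi_sq
  rw [h] at this
  norm_num at this

theorem phi_add_one_ne_zero : phi + 1 ≠ 0 := by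
  rw [← phi_sq]
  exact pow_ne_zero 2 phi_ne_zero

/-- Two coordinates of a point of the curve never vanish simultaneously. -/
theorem OnCurve.eq_of_zero {x : Color → ℂ} (h : OnCurve x) (hx : x ≠ 0) {a b : Color}
    (ha : x a = 0) (hb : x b = 0) : a = b := by
  obtain ⟨h1, h2, h3⟩ := h
  replace h3 : (phi + 1) * x 1 ^ 2 + x 2 ^ 2 + x 0 ^ 2 = 0 := h3
  by_contra hab
  have hp0 := phi_ne_zero
  have hp1 := sub_ne_zero.mpr phi_ne_one
  have hp2 := phi_add_one_ne_zero
  -- The five squares are linear forms in `x₁²` and `x₂²` with distinct zeros, so two vanishing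
  -- forms force both variables to vanish.
  have hX : x 1 ^ 2 = 0 ∧ x 2 ^ 2 = 0 := by
    fin_cases a <;> fin_cases b <;>
      first | exact absurd rfl hab | skip
    all_goals
      simp only [Fin.zero_eta, Fin.mk_one, Fin.reduceFinMk] at ha hb
      clear hx hab
      simp only [ha, hb, ne_eq, OfNat.ofNat_ne_zero, not_false_eq_true, zero_pow, true_and, and_true]
        at h1 h2 h3 ⊢ <;> grind
  apply hx
  have e1 := hX.1
  have e2 := hX.2
  rw [e1, e2] at h1 h2 h3
  simp only [mul_zero, zero_add] at h1 h2 h3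
  funext c
  fin_cases c <;> simp_all


/-- The `x`-coordinates of the points of order two on `E k`, in the order in which they are the
images of the points where `x_(k+1)`, `x_(k+2)`, `x_(k+3)` vanish. -/
noncomputable def torsionX (k : Color) : Fin 3 → ℂ :=
  match k with
  | 0 => ![phi, 1, 0]
  | 1 => ![0, 1, phi + 1]
  | 2 => ![phi, 1, 0]
  | 3 => ![1, 0, -phi]
  | 4 => ![0, 1, phi + 1]

theorem torsionX_nonsingular (k : Color) (i : Fin 3) : (E k).Nonsingular (torsionX k i) 0 := by
  refine E_nonsingular ?_
  fin_cases k <;> fin_cases i <;> simp [torsionX, root]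

theorem torsionX_ne (k : Color) : torsionX k 0 ≠ torsionX k 1 := by
  have h0 := phi_ne_zero
  have h1 := phi_ne_one
  fin_cases k <;> simp [torsionX, h1]

theorem torsionX_sum (k : Color) : torsionX k 0 + torsionX k 1 + torsionX k 2 = 1 + root k := by
  fin_cases k <;> simp [torsionX, root] <;> ring

theorem nuX_eq_torsionX {k : Color} {x : Color → ℂ} (hx : OnCurve x) (hk : x (k - 1) ≠ 0)
    (i : Fin 3) (hi : x (k + 1 + i.castLE (by norm_num)) = 0) : nuX k x = torsionX k i := by
  obtain ⟨h1, h2, h3⟩ := hx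
  replace h3 : (phi + 1) * x 1 ^ 2 + x 2 ^ 2 + x 0 ^ 2 = 0 := h3
  have hp := phi_sq
  fin_cases k
  · replace hk : x 4 ≠ 0 := hk
    fin_cases i
    · replace hi : x 1 = 0 := hi
      change -(x 0 ^ 2 / x 4 ^ 2) + phi + 1 = phi
      field_simp
      grind
    · replace hi : x 2 = 0 := hi
      change -(x 0 ^ 2 / x 4 ^ 2) + phi + 1 = 1
      field_simp
      grind
    · replace hi : x 3 = 0 := hi
      change -(x 0 ^ 2 / x 4 ^ 2) + phi + 1 = 0
      field_simp
      grind
  · replace hk : x 0 ≠ 0 := hk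
    fin_cases i
    · replace hi : x 2 = 0 := hi
      change -(2 * phi + 1) * (x 1 ^ 2 / x 0 ^ 2) - phi = 0
      field_simp
      grind
    · replace hi : x 3 = 0 := hi
      change -(2 * phi + 1) * (x 1 ^ 2 / x 0 ^ 2) - phi = 1
      field_simp
      grind
    · replace hi : x 4 = 0 := hi
      change -(2 * phi + 1) * (x 1 ^ 2 / x 0 ^ 2) - phi = phi + 1
      field_simp
      grind
  · replace hk : x 1 ≠ 0 := hk
    fin_cases i
    · replace hi : x 3 = 0 := hi
      change x 2 ^ 2 / x 1 ^ 2 + phi + 1 = phi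
      field_simp
      grind
    · replace hi : x 4 = 0 := hi
      change x 2 ^ 2 / x 1 ^ 2 + phi + 1 = 1
      field_simp
      grind
    · replace hi : x 0 = 0 := hi
      change x 2 ^ 2 / x 1 ^ 2 + phi + 1 = 0
      field_simp
      grind
  · replace hk : x 2 ≠ 0 := hk
    fin_cases i
    · replace hi : x 4 = 0 := hi
      change (2 * phi + 1) * (x 3 ^ 2 / x 2 ^ 2) + phi + 1 = 1
      field_simp
      grind
    · replace hi : x 0 = 0 := hi
      change (2 * phi + 1) * (x 3 ^ 2 / x 2 ^ 2) + phi + 1 = 0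
      field_simp
      grind
    · replace hi : x 1 = 0 := hi
      change (2 * phi + 1) * (x 3 ^ 2 / x 2 ^ 2) + phi + 1 = -phi
      field_simp
      grind
  · replace hk : x 3 ≠ 0 := hk
    fin_cases i
    · replace hi : x 0 = 0 := hi
      change (phi + 1) * (x 4 ^ 2 / x 3 ^ 2) - phi = 0
      field_simp
      grind
    · replace hi : x 1 = 0 := hi
      change (phi + 1) * (x 4 ^ 2 / x 3 ^ 2) - phi = 1
      field_simp
      grind
    · replace hi : x 2 = 0 := hi
      change (phi + 1) * (x 4 ^ 2 / x 3 ^ 2) - phi = phi + 1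
      field_simp
      grind

theorem nuY_eq_zero {k a : Color} {x : Color → ℂ} (ha : x a = 0) (hak : a ≠ k)
    (hak' : a ≠ k - 1) : nuY k x = 0 := by
  fin_cases k <;> fin_cases a <;> first
    | exact absurd rfl hak
    | exact absurd rfl hak'
    | (simp only [Fin.zero_eta, Fin.mk_one, Fin.reduceFinMk] at ha
       simp [nuY, ha])

theorem nu_eq_torsion {k : Color} {p : Curve} {x : Color → ℂ} (hx : Represents x p)
    (i : Fin 3) (hi : x (k + 1 + i.castLE (by norm_num)) = 0) :
    nu k p = .some (torsionX k i) 0 (torsionX_nonsingular k i) := by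
  have h1 : k + 1 + i.castLE (by norm_num) ≠ k - 1 :=
    (by decide : ∀ (k : Color) (i : Fin 3), k + 1 + Fin.castLE (_ : 3 ≤ 5) i ≠ k - 1) k i
  have h2 : k + 1 + i.castLE (by norm_num) ≠ k :=
    (by decide : ∀ (k : Color) (i : Fin 3), k + 1 + Fin.castLE (_ : 3 ≤ 5) i ≠ k) k i
  have hk : x (k - 1) ≠ 0 := fun h => h1 (hx.onCurve.eq_of_zero hx.ne_zero hi h)
  rw [nu_eq_some hx hk]
  exact some_congr (nuX_eq_torsionX hx.onCurve hk i hi) (nuY_eq_zero hi h2 h1)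

/-- The points where `x_k` vanishes are sent to points of order four. -/
theorem nu_add_self {k : Color} {p : Curve} {x : Color → ℂ} (hx : Represents x p)
    (hi : x k = 0) :
    nu k p + nu k p = .some (torsionX k 0) 0 (torsionX_nonsingular k 0) := by
  have hk : x (k - 1) ≠ 0 := fun h => by
    have := hx.onCurve.eq_of_zero hx.ne_zero hi h
    exact (by decide : ∀ k : Color, k ≠ k - 1) k this
  have hp := phi_sq
  have h0 := phi_ne_zero
  -- `2 φ + 1 = φ³` is a unit with inverse `2 φ - 3`.
  have h1 : 2 * phi + 1 ≠ 0 := fun h => by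
    have : (2 * phi + 1) * (2 * phi - 3) = 1 := by linear_combination 4 * hp
    rw [h, zero_mul] at this
    exact zero_ne_one this
  have hX : nuX k x = if k = 1 ∨ k = 4 then -phi else phi + 1 := by
    fin_cases k <;> simp only [Fin.zero_eta, Fin.mk_one, Fin.reduceFinMk] at hi <;>
      simp [nuX, hi]
  have hsq := E_sq_of_nonsingular (nu_nonsingular hx.onCurve hk)
  rw [nu_eq_some hx hk]
  have hs : nuY k x ^ 2 = (if k = 1 ∨ k = 4 then -(phi ^ 3 * (2 * phi + 1)) else
      if k = 3 then phi ^ 3 * (2 * phi + 1) else phi ^ 3) := by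
    rw [hsq, hX]
    fin_cases k <;> simp [root] <;> grind
  refine add_self_eq_two_torsion (fun hy => ?_) ?_
  · rw [hy] at hs
    have h3 := (pow_ne_zero 3 h0).symm
    fin_cases k <;> simp [h0, h1, h3] at hs
  · rw [hs, hX]
    fin_cases k <;> simp [root, torsionX] <;> grind

end Adinkra

namespace Adinkra

/-! ### Points over `0` and `∞` -/

/-- The squares of the coordinates of the points over `0`, up to a common factor. -/
noncomputable def weight : Color → ℂ
  | 0 => -zeta ^ 2 - zeta ^ 3
  | 1 => zeta ^ 2 - 1
  | 2 => 2 - zeta + zeta ^ 2 - zeta ^ 3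
  | 3 => -1 + zeta - 2 * zeta ^ 2 + zeta ^ 3
  | 4 => -1 - zeta ^ 3

/-- The inverses of the weights. -/
noncomputable def weightInv : Color → ℂ
  | 0 => (1 - 2 * zeta + 3 * zeta ^ 2 + zeta ^ 3) / 5
  | 1 => (-2 - zeta - zeta ^ 2 - 2 * zeta ^ 3) / 5
  | 2 => (1 + 3 * zeta - 2 * zeta ^ 2 + zeta ^ 3) / 5
  | 3 => (-2 - zeta - zeta ^ 2 + 3 * zeta ^ 3) / 5
  | 4 => (-3 + zeta + zeta ^ 2 + 2 * zeta ^ 3) / 5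

theorem weight_mul_inv (a : Color) : weight a * weightInv a = 1 := by
  have hz := zeta_pow_four
  fin_cases a <;> simp only [weight, weightInv] <;> grind

theorem weight_ne_zero (a : Color) : weight a ≠ 0 :=
  left_ne_zero_of_mul_eq_one (weight_mul_inv a)

/-- The factor by which the coordinate `a` changes along an edge of colour `j` from a black vertex. -/
noncomputable def edgeFactor (j a : Color) : ℂ :=
  (if j = a ∨ j = a + 2 then -1 else 1) * (-zeta) ^ (4 * a.val)

/-- The `x`-coordinates of the images in `E k` of the points over `0`. -/
noncomputable def blackX : Color → ℂ
  | 0 => 1 - zeta ^ 3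
  | 1 => zeta + zeta ^ 3
  | 2 => 1 - zeta ^ 3
  | 3 => 1 - zeta - zeta ^ 3
  | 4 => zeta + zeta ^ 3

/-- The `x`-coordinates of the images in `E k` of the points over `∞`. -/
noncomputable def whiteX : Color → ℂ
  | 0 => 1 + zeta ^ 2
  | 1 => 1 - zeta - zeta ^ 3
  | 2 => 1 + zeta ^ 2
  | 3 => zeta + zeta ^ 3
  | 4 => 1 - zeta - zeta ^ 3

theorem nuX_black (k : Color) {x : Color → ℂ} {ρ : ℂ} (hρ : ρ ≠ 0)
    (hx : ∀ a, x a ^ 2 = ρ * weight a) : nuX k x = blackX k := by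
  have hz := zeta_pow_four
  have hp := phi_eq
  have h : ∀ a b, x a ^ 2 / x b ^ 2 = weight a * weightInv b := by
    intro a b
    rw [hx, hx, mul_div_mul_left _ _ hρ, div_eq_iff (weight_ne_zero b), mul_assoc,
      mul_comm (weightInv b), weight_mul_inv, mul_one]
  fin_cases k
  · change -(x 0 ^ 2 / x 4 ^ 2) + phi + 1 = _
    rw [h]; simp only [weight, weightInv, blackX]; grind
  · change -(2 * phi + 1) * (x 1 ^ 2 / x 0 ^ 2) - phi = _
    rw [h]; simp only [weight, weightInv, blackX]; grind
  · change x 2 ^ 2 / x 1 ^ 2 + phi + 1 = _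
    rw [h]; simp only [weight, weightInv, blackX]; grind
  · change (2 * phi + 1) * (x 3 ^ 2 / x 2 ^ 2) + phi + 1 = _
    rw [h]; simp only [weight, weightInv, blackX]; grind
  · change (phi + 1) * (x 4 ^ 2 / x 3 ^ 2) - phi = _
    rw [h]; simp only [weight, weightInv, blackX]; grind

theorem edgeFactor_sq (j a : Color) : edgeFactor j a ^ 2 = zeta ^ (8 * a.val) := by
  unfold edgeFactor
  rw [mul_pow, ite_pow, ← pow_mul, neg_one_sq, one_pow, ite_self, one_mul, Even.neg_pow]
  · congr 1; ring
  · exact ⟨4 * a.val, by ring⟩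

theorem edgeFactor_ne_zero (j a : Color) : edgeFactor j a ≠ 0 := by
  have : edgeFactor j a ^ 2 ≠ 0 := by
    rw [edgeFactor_sq]
    exact pow_ne_zero _ zeta_ne_zero
  exact fun h => this (by rw [h]; simp)

theorem nuX_white (k j : Color) {x y : Color → ℂ} {ρ : ℂ} (hρ : ρ ≠ 0)
    (hx : ∀ a, x a ^ 2 = ρ * weight a) (hy : ∀ a, y a = x a * edgeFactor j a) :
    nuX k y = whiteX k := by
  have hz := zeta_pow_four
  have hz5 := zeta_pow_five
  have hp := phi_eq
  have h : ∀ a b, y a ^ 2 / y b ^ 2 = weight a * weightInv b * zeta ^ (8 * a.val + 2 * b.val) := by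
    intro a b
    have h10 : zeta ^ (2 * b.val) * zeta ^ (8 * b.val) = 1 := by
      rw [← pow_add, show 2 * b.val + 8 * b.val = 10 * b.val by ring, pow_mul, zeta_pow_ten,
        one_pow]
    rw [hy, hy, mul_pow, mul_pow, hx, hx, edgeFactor_sq, edgeFactor_sq, div_eq_iff
      (mul_ne_zero (mul_ne_zero hρ (weight_ne_zero b)) (pow_ne_zero _ zeta_ne_zero)), pow_add]
    linear_combination (-ρ * weight a * zeta ^ (8 * a.val) * weight b * weightInv b) * h10 -
      ρ * weight a * zeta ^ (8 * a.val) * weight_mul_inv b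
  have h6 : zeta ^ 6 = -zeta := by linear_combination zeta * hz5
  have h8 : zeta ^ 8 = -zeta ^ 3 := by linear_combination zeta ^ 3 * hz5
  fin_cases k
  · change -(y 0 ^ 2 / y 4 ^ 2) + phi + 1 = _
    rw [h, show zeta ^ (8 * (0 : Color).val + 2 * (4 : Color).val) = -zeta ^ 3 from h8]
    simp only [weight, weightInv, whiteX]; grind
  · change -(2 * phi + 1) * (y 1 ^ 2 / y 0 ^ 2) - phi = _
    rw [h, show zeta ^ (8 * (1 : Color).val + 2 * (0 : Color).val) = -zeta ^ 3 from h8]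
    simp only [weight, weightInv, whiteX]; grind
  · change y 2 ^ 2 / y 1 ^ 2 + phi + 1 = _
    rw [h, show zeta ^ (8 * (2 : Color).val + 2 * (1 : Color).val) = -zeta ^ 3 by
      change zeta ^ 18 = _
      linear_combination zeta ^ 8 * zeta_pow_ten + h8]
    simp only [weight, weightInv, whiteX]; grind
  · change (2 * phi + 1) * (y 3 ^ 2 / y 2 ^ 2) + phi + 1 = _
    rw [h, show zeta ^ (8 * (3 : Color).val + 2 * (2 : Color).val) = -zeta ^ 3 by
      change zeta ^ 28 = _
      linear_combination (zeta ^ 8 + zeta ^ 18) * zeta_pow_ten + h8]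
    simp only [weight, weightInv, whiteX]; grind
  · change (phi + 1) * (y 4 ^ 2 / y 3 ^ 2) - phi = _
    rw [h, show zeta ^ (8 * (4 : Color).val + 2 * (3 : Color).val) = -zeta ^ 3 by
      change zeta ^ 38 = _
      linear_combination (zeta ^ 8 + zeta ^ 18 + zeta ^ 28) * zeta_pow_ten + h8]
    simp only [weight, weightInv, whiteX]; grind

/-- For colour `k-2` the two signs in `edgeFactor` fall on `x_{k+1}` and `x_{k+3}`, both in the
numerator of `nuY`, and cancel. The remaining fifth roots of unity multiply to `-ζ`. -/
theorem nuY_white (k : Color) {x y : Color → ℂ} (hx : x (k - 1) ≠ 0)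
    (hy : ∀ a, y a = x a * edgeFactor (k - 2) a) : nuY k y = -zeta * nuY k x := by
  have hz5 := zeta_pow_five
  have key : ∀ a b c d : Color, edgeFactor (k - 2) a * edgeFactor (k - 2) b *
      edgeFactor (k - 2) c = -zeta * edgeFactor (k - 2) d ^ 3 →
      y a * y b * y c / y d ^ 3 = -zeta * (x a * x b * x c / x d ^ 3) := by
    intro a b c d h
    have hd := pow_ne_zero 3 (edgeFactor_ne_zero (k - 2) d)
    rw [hy, hy, hy, hy, mul_pow, show x a * edgeFactor (k - 2) a * (x b * edgeFactor (k - 2) b) *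
      (x c * edgeFactor (k - 2) c) = (x a * x b * x c) * (edgeFactor (k - 2) a *
      edgeFactor (k - 2) b * edgeFactor (k - 2) c) by ring, h, mul_div_mul_comm,
      mul_div_cancel_right₀ _ hd]
    ring
  have pows : ∀ a : Color, (-zeta) ^ (4 * a.val) =
      (![1, zeta ^ 4, -zeta ^ 3, zeta ^ 2, -zeta] : Color → ℂ) a := by
    intro a
    fin_cases a
    · rfl
    · change (-zeta) ^ 4 = zeta ^ 4
      ring
    · change (-zeta) ^ 8 = -zeta ^ 3
      linear_combination zeta ^ 3 * hz5
    · change (-zeta) ^ 12 = zeta ^ 2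
      linear_combination zeta ^ 2 * zeta_pow_ten
    · change (-zeta) ^ 16 = -zeta
      linear_combination zeta ^ 6 * zeta_pow_ten + zeta * hz5
  fin_cases k
  · change Complex.I * (y 1 * y 2 * y 3 / y 4 ^ 3) =
      -zeta * (Complex.I * (x 1 * x 2 * x 3 / x 4 ^ 3))
    rw [key]
    · ring
    · simp only [edgeFactor, pows]
      simp [Fin.ext_iff]
      grind
  · change (2 * phi + 1) * (y 2 * y 3 * y 4 / y 0 ^ 3) =
      -zeta * ((2 * phi + 1) * (x 2 * x 3 * x 4 / x 0 ^ 3))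
    rw [key]
    · ring
    · simp only [edgeFactor, pows]
      simp [Fin.ext_iff]
      grind
  · change Complex.I * (y 3 * y 4 * y 0 / y 1 ^ 3) =
      -zeta * (Complex.I * (x 3 * x 4 * x 0 / x 1 ^ 3))
    rw [key]
    · ring
    · simp only [edgeFactor, pows]
      simp [Fin.ext_iff]
      grind
  · change Complex.I * (2 * phi + 1) * (y 1 * y 4 * y 0 / y 2 ^ 3) =
      -zeta * (Complex.I * (2 * phi + 1) * (x 1 * x 4 * x 0 / x 2 ^ 3))
    rw [key]
    · ring
    · simp only [edgeFactor, pows]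
      simp [Fin.ext_iff]
      grind
  · change Complex.I * phi * (y 1 * y 2 * y 0 / y 3 ^ 3) =
      -zeta * (Complex.I * phi * (x 1 * x 2 * x 0 / x 3 ^ 3))
    rw [key]
    · ring
    · simp only [edgeFactor, pows]
      simp [Fin.ext_iff]
      grind

/-- The points `p` over `0` and `q` over `∞` are joined by a lift of the ray of colour `j`. -/
def EdgePair (j : Color) (p q : Curve) : Prop :=
  ∃ x y ρ, Represents x p ∧ Represents y q ∧ ρ ≠ 0 ∧ (∀ a, x a ^ 2 = ρ * weight a) ∧
    ∀ a, y a = x a * edgeFactor j a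

theorem coord_ne_zero {x : Color → ℂ} {ρ : ℂ} (hρ : ρ ≠ 0) (hx : ∀ a, x a ^ 2 = ρ * weight a)
    (a : Color) : x a ≠ 0 := by
  intro h
  have := hx a
  rw [h] at this
  exact mul_ne_zero hρ (weight_ne_zero a) (by rw [← this]; simp)

/-- Both `x`-coordinates are known and the `y`-coordinates have ratio `-ζ`. Once `y²` is eliminated
by the curve equation, collinearity with the 2-torsion point is an identity in `ℤ[ζ]`. -/
theorem EdgePair.nu_add {k : Color} {p q : Curve} (h : EdgePair (k - 2) p q) :
    nu k p + nu k q = .some (torsionX k 0) 0 (torsionX_nonsingular k 0) := by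
  obtain ⟨x, y, ρ, hx, hy, hρ, hxρ, hxy⟩ := h
  have hk := coord_ne_zero hρ hxρ (k - 1)
  have hk' : y (k - 1) ≠ 0 := by rw [hxy]; exact mul_ne_zero hk (edgeFactor_ne_zero _ _)
  have hz := zeta_pow_four
  have hz0 := zeta_ne_zero
  rw [nu_eq_some hx hk, nu_eq_some hy hk']
  have hX := nuX_black k hρ hxρ
  have hW := nuX_white k (k - 2) hρ hxρ hxy
  have hY := nuY_white k hk hxy
  have hsq := E_sq_of_nonsingular (nu_nonsingular hx.onCurve hk)
  rw [hX] at hsq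
  refine add_eq_of_collinear ?_ ?_ ?_
  · rw [hX, hW]
    intro h
    fin_cases k <;> simp only [blackX, whiteX] at h <;> grind
  · rw [hX, hW, hY, show ∀ y : ℂ, (y - -zeta * y) ^ 2 = (1 + zeta) ^ 2 * y ^ 2 by intro y; ring, hsq]
    fin_cases k <;> simp [blackX, whiteX, root, torsionX, phi_eq] <;> grind
  · rw [hX, hW, hY]
    fin_cases k <;> simp [blackX, whiteX, torsionX, phi_eq] <;> grind


/-- An integral multiple of the inverse of `blackX k ^ 2 - root k`. -/
noncomputable def blackInv : Color → ℂ
  | 0 => 1 - zeta + zeta ^ 3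
  | 1 => 1 - 7 * zeta + 8 * zeta ^ 2 - 4 * zeta ^ 3
  | 2 => 1 - zeta + zeta ^ 3
  | 3 => -1 + zeta
  | 4 => 1 - 7 * zeta + 8 * zeta ^ 2 - 4 * zeta ^ 3

theorem blackInv_spec (k : Color) : (blackX k ^ 2 - root k) * blackInv k = 1 ∨
    (blackX k ^ 2 - root k) * blackInv k = 5 := by
  have hz := zeta_pow_four
  fin_cases k <;> simp only [blackX, blackInv, root, phi_eq]
  · left; grind
  · right; grind
  · left; grind
  · left; grind
  · right; grind

theorem nuY_ne_zero (k : Color) {x : Color → ℂ} (hx : ∀ a, x a ≠ 0) : nuY k x ≠ 0 := by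
  have h1 : 2 * phi + 1 ≠ 0 := fun h => by
    have : (2 * phi + 1) * (2 * phi - 3) = 1 := by linear_combination 4 * phi_sq
    rw [h, zero_mul] at this
    exact zero_ne_one this
  fin_cases k <;> simp [nuY, hx, h1, phi_ne_zero]

theorem not_isOfFinAddOrder_black (k : Color) {p : Curve} {x : Color → ℂ} {ρ : ℂ}
    (hx : Represents x p) (hρ : ρ ≠ 0) (hxρ : ∀ a, x a ^ 2 = ρ * weight a) :
    ¬ IsOfFinAddOrder (nu k p) := by
  obtain ⟨A, hA⟩ := exists_valuationSubring_two
  have hk := coord_ne_zero hρ hxρ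
  have hy := nuY_ne_zero k hk
  have hs := E_sq_of_nonsingular (nu_nonsingular hx.onCurve (hk (k - 1)))
  rw [nu_eq_some hx (hk (k - 1))]
  obtain ⟨y', h', he⟩ := add_self_some (nu_nonsingular hx.onCurve (hk (k - 1))) hy
  have hmem : ∀ {c : ℂ}, c ∈ A → A.valuation c ≤ 1 := (A.valuation_le_one_iff _).mpr
  have hz : zeta ∈ A := zeta_mem
  have hX : blackX k ∈ A := by
    fin_cases k
    · exact sub_mem (one_mem A) (pow_mem hz 3)
    · exact add_mem hz (pow_mem hz 3)
    · exact sub_mem (one_mem A) (pow_mem hz 3)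
    · exact sub_mem (sub_mem (one_mem A) hz) (pow_mem hz 3)
    · exact add_mem hz (pow_mem hz 3)
  have hI : blackInv k ∈ A := by
    have h1 : 1 - zeta + zeta ^ 3 ∈ A := add_mem (sub_mem (one_mem A) hz) (pow_mem hz 3)
    have h2 : 1 - 7 * zeta + 8 * zeta ^ 2 - 4 * zeta ^ 3 ∈ A :=
      sub_mem (add_mem (sub_mem (one_mem A) (mul_mem (ofNat_mem A 7) hz))
        (mul_mem (ofNat_mem A 8) (pow_mem hz 2))) (mul_mem (ofNat_mem A 4) (pow_mem hz 3))
    fin_cases k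
    · exact h1
    · exact h2
    · exact h1
    · exact add_mem (neg_mem (one_mem A)) hz
    · exact h2
  have h5 : A.valuation 5 = 1 := by
    have h4 : A.valuation 4 < 1 := by
      rw [show (4 : ℂ) = 2 * 2 by norm_num, map_mul]
      exact mul_lt_one_of_lt_of_le hA hA.le
    rw [show (5 : ℂ) = 1 + 4 by norm_num, Valuation.map_add_eq_of_lt_left, map_one]
    rwa [map_one]
  -- The factor `blackInv k` is integral and the product is `1` or `5`, of valuation one; so the
  -- numerator of the duplication formula is not divisible by the place, while its denominator is.
  have hsq : 1 ≤ A.valuation (blackX k ^ 2 - root k) := by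
    have h1 : A.valuation (blackX k ^ 2 - root k) * A.valuation (blackInv k) = 1 := by
      rw [← map_mul]
      rcases blackInv_spec k with h | h <;> rw [h]
      · exact map_one _
      · exact h5
    rw [← h1]
    exact mul_le_of_le_one_right' (hmem hI)
  have hden : A.valuation (4 * nuY k x ^ 2) < 1 := by
    rw [hs, nuX_black k hρ hxρ, show (4 : ℂ) = 2 * 2 by norm_num, mul_assoc, map_mul]
    refine mul_lt_one_of_lt_of_le hA (hmem (mul_mem (ofNat_mem A 2) (mul_mem (mul_mem hX ?_) ?_)))
    · exact sub_mem hX (one_mem A)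
    · exact sub_mem hX (root_mem k)
  have hlt : 1 < A.valuation ((nuX k x ^ 2 - root k) ^ 2 / (4 * nuY k x ^ 2)) := by
    rw [nuX_black k hρ hxρ, map_div₀, map_pow]
    have h0 : A.valuation (4 * nuY k x ^ 2) ≠ 0 :=
      (Valuation.ne_zero_iff _).mpr (mul_ne_zero (by norm_num) (pow_ne_zero 2 hy))
    rw [lt_div_iff₀ (zero_lt_iff.mpr h0), one_mul]
    exact hden.trans_le (one_le_pow₀ hsq)
  intro hfin
  refine not_isOfFinAddOrder_of_valuation hA h' hlt ?_
  rw [← he, ← two_nsmul]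
  exact hfin.nsmul

/-! ### The relations on the elliptic curves -/

/-- Configurations of vertices and face centres on the curve with the incidences and symmetries of
an embedding. -/
structure Configuration (V : Vertex → Curve) (F : Face → Curve) : Prop where
  edge : ∀ v j, EdgePair j (V v) (V (nbr v j)) ∨ EdgePair j (V (nbr v j)) (V v)
  flip_vertex : ∀ v j, Flipped (j + 2) (V (nbr v j)) (V (nbr v (j + 1)))
  flip_center : ∀ v i j, Flipped (j + 2) (F (face i v)) (F (face i (nbr (nbr v j) (j + 1))))
  center_zero : ∀ v j, ∃ x, Represents x (F (face j v)) ∧ x (j + 2) = 0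

variable {V : Vertex → Curve} {F : Face → Curve}

theorem Configuration.morseRelations (H : Configuration V F) (k : Color) :
    MorseRelations k (fun v => nu k (V v)) (fun f => nu k (F f)) where
  nbr_neg v j hj := by
    rw [(H.flip_vertex v j).nu_eq, if_neg]
    exact fun h => hj (eq_sub_of_add_eq h)
  nbr_eq v := by
    rw [show k - 1 = k - 2 + 1 by grind, (H.flip_vertex v (k - 2)).nu_eq, if_pos (by simp)]
  torsion := by
    -- The ordinary centres are the zeros of `x_{k+1}`, `x_{k+2}`, `x_{k+3}`, `x_{k-1}`: the three
    -- points of order two and the identity.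
    obtain ⟨T, h1, h2, h3, h4⟩ : ∃ T : Color → (E k).Point,
        T (k - 1) = .some _ 0 (torsionX_nonsingular k 0) ∧
        T k = .some _ 0 (torsionX_nonsingular k 1) ∧
        T (k + 1) = .some _ 0 (torsionX_nonsingular k 2) ∧ T (k + 2) = 0 := by
      refine ⟨fun j => if j = k - 1 then .some _ 0 (torsionX_nonsingular k 0) else
        if j = k then .some _ 0 (torsionX_nonsingular k 1) else
        if j = k + 1 then .some _ 0 (torsionX_nonsingular k 2) else 0, ?_, ?_, ?_, ?_⟩ <;>
        dsimp only
      · rw [if_pos rfl]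
      · rw [if_neg (by grind), if_pos rfl]
      · rw [if_neg (by grind), if_neg (by simp), if_pos rfl]
      · rw [if_neg (by grind), if_neg (by simp), if_neg (by simp)]
    refine ⟨fun j => if j = k - 2 then 0 else T j, ?_, ?_, ?_⟩
    · intro j hj v
      dsimp only
      rw [if_neg hj]
      obtain ⟨x, hx, hx0⟩ := H.center_zero v j
      have hc : j = k - 1 ∨ j = k ∨ j = k + 1 ∨ j = k + 2 := by grind
      rcases hc with h | h | h | h
      · rw [h, h1, ← h]
        refine nu_eq_torsion hx 0 ?_
        rw [← hx0, h]
        exact congrArg x ((by decide : ∀ k : Color,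
          k + 1 + Fin.castLE (_ : 3 ≤ 5) (0 : Fin 3) = k - 1 + 2) k)
      · rw [h, h2, ← h]
        refine nu_eq_torsion hx 1 ?_
        rw [← hx0]
        exact congrArg x ((by decide : ∀ j : Color,
          j + 1 + Fin.castLE (_ : 3 ≤ 5) (1 : Fin 3) = j + 2) j)
      · rw [h, h3, ← h]
        refine nu_eq_torsion hx 2 ?_
        rw [← hx0, h]
        exact congrArg x ((by decide : ∀ k : Color,
          k + 1 + Fin.castLE (_ : 3 ≤ 5) (2 : Fin 3) = k + 1 + 2) k)
      · rw [h, h4, ← h]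
        refine nu_eq_zero hx ?_
        rw [← hx0, h]
        congr 1
        grind
    · intro j
      have hc : j = k - 2 ∨ j = k - 1 ∨ j = k ∨ j = k + 1 ∨ j = k + 2 := by grind
      dsimp only
      split_ifs with hj
      · exact neg_zero
      rcases hc with h | h | h | h | h
      · exact absurd h hj
      · rw [h, h1]; exact neg_some_eq rfl (by simp)
      · rw [h, h2]; exact neg_some_eq rfl (by simp)
      · rw [h, h3]; exact neg_some_eq rfl (by simp)
      · rw [h, h4]; exact neg_zero
    · dsimp only
      rw [if_neg (by simp), if_neg (by grind), if_neg (by grind), if_neg (by grind), h1, h2, h3, h4,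
        add_zero]
      exact add_two_torsion (torsionX_ne k) (torsionX_sum k)
  center_neg v j hj := by
    rw [(H.flip_center v (k - 2) j).nu_eq, if_neg]
    exact fun h => hj (eq_sub_of_add_eq h)
  add_nbr v := by
    obtain ⟨x, hx, hx0⟩ := H.center_zero v (k - 2)
    rw [sub_add_cancel] at hx0
    rw [nu_add_self hx hx0]
    rcases H.edge v (k - 2) with h | h
    · exact h.nu_add
    · rw [add_comm]
      exact h.nu_add

/-- The centre is killed by `4`, so it can be removed. If the top vertex lies over `∞`, its
neighbour of colour `k-2` lies over `0`, and `add_nbr` carries torsion from one to the other. -/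
theorem Configuration.not_isOfFinAddOrder (H : Configuration V F) (k : Color) :
    ¬ IsOfFinAddOrder (nu k (V 1) - nu k (F (face (k - 2) 1))) := by
  intro hfin
  have R := H.morseRelations k
  obtain ⟨x, hx, hx0⟩ := H.center_zero 1 (k - 2)
  rw [sub_add_cancel] at hx0
  have hc : IsOfFinAddOrder (nu k (F (face (k - 2) 1))) := by
    refine isOfFinAddOrder_iff_nsmul_eq_zero.mpr ⟨2 * 2, by norm_num, ?_⟩
    rw [mul_nsmul, two_nsmul (nu k _), nu_add_self hx hx0, two_nsmul]
    nth_rw 1 [← neg_some_eq (h := torsionX_nonsingular k 0) rfl (by simp)]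
    exact neg_add_cancel _
  have h1 : IsOfFinAddOrder (nu k (V 1)) := by
    have := hfin.add hc
    rwa [sub_add_cancel] at this
  have h2 : IsOfFinAddOrder (nu k (V (nbr 1 (k - 2)))) := by
    rw [eq_sub_of_add_eq' (R.add_nbr 1), sub_eq_add_neg]
    exact (hc.add hc).add h1.neg
  rcases H.edge 1 (k - 2) with ⟨x, y, ρ, hx, hy, hρ, hxρ, -⟩ | ⟨x, y, ρ, hx, hy, hρ, hxρ, -⟩
  · exact not_isOfFinAddOrder_black k hx hρ hxρ h1
  · exact not_isOfFinAddOrder_black k hx hρ hxρ h2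

end Adinkra

namespace Adinkra

/-! ### Lifting paths -/

/-- The linear form on the beach ball that vanishes at the branch point of the coordinate `a`. -/
noncomputable def branchForm (a : Color) (u w : ℂ) : ℂ := w - u * zeta ^ (13 - 2 * a.val)

/-- Up to a common factor, the square of the coordinate `a` of the points over `[u : w]`. -/
noncomputable def squareForm (a : Color) (u w : ℂ) : ℂ := weight a * branchForm a u w

/-- The exponent `13` in `branchForm` stands for `3` modulo `10`; it keeps the natural subtraction
`13 - 2 a` from truncating. -/
theorem squareForm_eq (u w : ℂ) :
    squareForm 0 u w = (-zeta ^ 2 - zeta ^ 3) * (w - u * zeta ^ 3) ∧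
    squareForm 1 u w = (zeta ^ 2 - 1) * (w - u * zeta) ∧
    squareForm 2 u w = (2 - zeta + zeta ^ 2 - zeta ^ 3) * (w + u * zeta ^ 4) ∧
    squareForm 3 u w = (-1 + zeta - 2 * zeta ^ 2 + zeta ^ 3) * (w + u * zeta ^ 2) ∧
    squareForm 4 u w = (-1 - zeta ^ 3) * (w + u) := by
  have hz5 := zeta_pow_five
  have h7 : zeta ^ 7 = -zeta ^ 2 := by linear_combination zeta ^ 2 * hz5
  have h9 : zeta ^ 9 = -zeta ^ 4 := by linear_combination zeta ^ 4 * hz5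
  have h11 : zeta ^ 11 = zeta := by linear_combination zeta * zeta_pow_ten
  have h13 : zeta ^ 13 = zeta ^ 3 := by linear_combination zeta ^ 3 * zeta_pow_ten
  refine ⟨?_, ?_, ?_, ?_, ?_⟩
  · change weight 0 * (w - u * zeta ^ 13) = _
    rw [h13]; rfl
  · change weight 1 * (w - u * zeta ^ 11) = _
    rw [h11]; rfl
  · change weight 2 * (w - u * zeta ^ 9) = _
    rw [h9, mul_neg, sub_neg_eq_add]; rfl
  · change weight 3 * (w - u * zeta ^ 7) = _
    rw [h7, mul_neg, sub_neg_eq_add]; rfl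
  · change weight 4 * (w - u * zeta ^ 5) = _
    rw [hz5, mul_neg, mul_one, sub_neg_eq_add]; rfl

theorem squareForm_relations (u w : ℂ) :
    squareForm 1 u w + squareForm 2 u w + squareForm 3 u w = 0 ∧
    phi * squareForm 1 u w + squareForm 2 u w + squareForm 4 u w = 0 ∧
    (phi + 1) * squareForm 1 u w + squareForm 2 u w + squareForm 0 u w = 0 := by
  have hz := zeta_pow_four
  obtain ⟨h0, h1, h2, h3, h4⟩ := squareForm_eq u w
  rw [h0, h1, h2, h3, h4, phi_eq]
  refine ⟨?_, ?_, ?_⟩ <;> grind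

theorem onCurve_of_sq {x : Color → ℂ} {ρ u w : ℂ} (h : ∀ a, x a ^ 2 = ρ * squareForm a u w) :
    OnCurve x := by
  obtain ⟨h1, h2, h3⟩ := squareForm_relations u w
  replace h3 : (phi + 1) * squareForm 1 u w + squareForm 2 u w + squareForm 5 u w = 0 := h3
  refine ⟨?_, ?_, ?_⟩
  · rw [h, h, h]; linear_combination ρ * h1
  · rw [h, h, h]; linear_combination ρ * h2
  · rw [h, h, h]; linear_combination ρ * h3

theorem liesOver_iff (x : Color → ℂ) (u w : ℂ) :
    LiesOver x u w ↔ x 2 ^ 2 * squareForm 1 u w = x 1 ^ 2 * squareForm 2 u w := by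
  obtain ⟨-, h1, h2, -, -⟩ := squareForm_eq u w
  have hz5 := zeta_pow_five
  have hz := zeta_pow_four
  have e1 : (u - zeta⁻¹ * w) * (zeta - zeta ^ 3) = squareForm 1 u w := by
    rw [h1, zeta_inv]
    linear_combination (w - w * zeta ^ 2) * hz5
  have e2 : (u - zeta * w) * (zeta ^ 3 - zeta⁻¹) = squareForm 2 u w := by
    rw [h2, zeta_inv]
    grind
  rw [LiesOver, e1, e2]

/-- The squares of the coordinates and the square forms depend on their entries `1` and `2` through
the same coefficients `α`, `β`; proportionality of two entries is therefore proportionality of all.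
-/
theorem cross_mul {x : Color → ℂ} {u w : ℂ} (hx : OnCurve x) (h : LiesOver x u w) (a b : Color) :
    x a ^ 2 * squareForm b u w = x b ^ 2 * squareForm a u w := by
  rw [liesOver_iff] at h
  obtain ⟨h1, h2, h3⟩ := squareForm_relations u w
  obtain ⟨k1, k2, k3⟩ := hx
  replace k3 : (phi + 1) * x 1 ^ 2 + x 2 ^ 2 + x 0 ^ 2 = 0 := k3
  set α : Color → ℂ := ![-(phi + 1), 1, 0, -1, -phi] with hα
  set β : Color → ℂ := ![-1, 0, 1, -1, -1] with hβ
  have hX : ∀ a, x a ^ 2 = α a * x 1 ^ 2 + β a * x 2 ^ 2 := by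
    intro a
    fin_cases a <;> simp [hα, hβ]
    · linear_combination k3
    · linear_combination k1
    · linear_combination k2
  have hL : ∀ a, squareForm a u w = α a * squareForm 1 u w + β a * squareForm 2 u w := by
    intro a
    fin_cases a <;> simp [hα, hβ]
    · linear_combination h3
    · linear_combination h1
    · linear_combination h2
  rw [hX a, hX b, hL a, hL b]
  linear_combination (β a * α b - α a * β b) * h

/-- Transport of homogeneous coordinates along lifts of a path, in terms of square roots `δ` of the
forms `branchForm` along the path. -/
theorem JoinedOver.transport {z : unitInterval → ℂ × ℂ} {P Q : Curve} (h : JoinedOver z P Q)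
    {δ : unitInterval → Color → ℂ} (hδ : Continuous δ) {c : Color → ℂ} (hc : ∀ a, c a ≠ 0)
    (hsq : ∀ t a, δ t a ^ 2 = c a * branchForm a (z t).1 (z t).2)
    (h1 : ∀ a, (∀ t, δ t a ≠ 0) ∨ δ 1 a = 0)
    {a₀ : Color} (ha₀ : ∀ t, δ t a₀ ≠ 0) {x : Color → ℂ} (hx : Represents x P) :
    Represents (fun a => x a * (δ 1 a / δ 0 a)) Q := by
  obtain ⟨γ, hγ, hover, hP, hQ⟩ := h
  have hform : ∀ {a t}, δ t a ≠ 0 → squareForm a (z t).1 (z t).2 ≠ 0 := by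
    intro a t hne
    refine mul_ne_zero (weight_ne_zero a) fun h => hne ?_
    have := hsq t a
    rw [h, mul_zero] at this
    exact pow_eq_zero_iff (two_ne_zero) |>.mp this
  have hγne : ∀ {t a}, δ t a ≠ 0 → γ t a ≠ 0 := by
    intro t a hne hz
    have hb : ∀ b, γ t b = 0 := by
      intro b
      have := cross_mul (hover t).1 (hover t).2 a b
      rw [hz, zero_pow two_ne_zero, zero_mul] at this
      simpa [hform hne] using this.symm
    exact hγ t (funext hb)
  have hγc : ∀ a, Continuous fun t => γ t a := fun a => (continuous_apply a).comp γ.continuous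
  have hδc : ∀ a, Continuous fun t => δ t a := fun a => (continuous_apply a).comp hδ
  have key : ∀ a, γ 1 a = (γ 1 a₀ * δ 0 a₀ / (γ 0 a₀ * δ 1 a₀)) * (γ 0 a * (δ 1 a / δ 0 a)) := by
    intro a
    rcases h1 a with ha | ha
    -- This continuous function has constant square, so it is constant on the connected interval;
    -- hence the ratio of the lift to `δ` changes by the same factor in all nonvanishing
    -- coordinates.
    · set g : unitInterval → ℂ := fun t => γ t a * δ t a₀ / (γ t a₀ * δ t a) with hg
      have hgc : Continuous g :=
        ((hγc a).mul (hδc a₀)).div ((hγc a₀).mul (hδc a)) fun t =>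
          mul_ne_zero (hγne (ha₀ t)) (ha t)
      have hg2 : ∀ t, g t ^ 2 = weight a * c a₀ / (weight a₀ * c a) := by
        intro t
        have e := cross_mul (hover t).1 (hover t).2 a a₀
        have f1 := hform (ha t)
        have f2 := hform (ha₀ t)
        have n1 := hγne (ha₀ t)
        have n2 := weight_ne_zero a
        have n3 := weight_ne_zero a₀
        have n4 := hc a
        have n5 := hc a₀
        simp only [hg]
        rw [div_pow, mul_pow, mul_pow, hsq, hsq]
        unfold squareForm at e f1 f2
        rw [div_eq_div_iff (by
          exact mul_ne_zero (pow_ne_zero 2 n1) (mul_ne_zero n4 (right_ne_zero_of_mul f1)))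
          (mul_ne_zero n3 n4)]
        linear_combination c a₀ * c a * e
      have hconst : g 1 = g 0 := by
        refine isPreconnected_univ.eq_of_sq_eq (f := g) (g := fun _ => g 0) hgc.continuousOn
          continuousOn_const (fun t _ => ?_) (fun _ => ?_) (Set.mem_univ 0) rfl (Set.mem_univ 1)
        · simp only [Pi.pow_apply, hg2]
        · exact div_ne_zero (mul_ne_zero (hγne (ha 0)) (ha₀ 0)) (mul_ne_zero (hγne (ha₀ 0)) (ha 0))
      simp only [hg] at hconst
      have m1 := hγne (ha₀ 0)
      have m2 := hγne (ha₀ 1)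
      have m3 := ha 0
      have m4 := ha 1
      have m5 := ha₀ 0
      have m6 := ha₀ 1
      rw [div_eq_div_iff (mul_ne_zero m2 m4) (mul_ne_zero m1 m3)] at hconst
      field_simp
      linear_combination hconst
    · rw [ha, zero_div, mul_zero, mul_zero]
      have e := cross_mul (hover 1).1 (hover 1).2 a a₀
      have hb : branchForm a (z 1).1 (z 1).2 = 0 := by
        have := hsq 1 a
        rw [ha, zero_pow two_ne_zero] at this
        simpa [hc a] using this.symm
      rw [squareForm, squareForm, hb, mul_zero, mul_zero, ← squareForm] at e
      simpa [hform (ha₀ 1)] using e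
  set K := γ 1 a₀ * δ 0 a₀ / (γ 0 a₀ * δ 1 a₀) with hK
  have hK0 : K ≠ 0 := div_ne_zero (mul_ne_zero (hγne (ha₀ 1)) (ha₀ 0))
    (mul_ne_zero (hγne (ha₀ 0)) (ha₀ 1))
  obtain ⟨d, hd, hxd⟩ := Represents.exists_smul ⟨hγ 0, hP⟩ hx
  have hrep : Represents (γ 1) Q := ⟨hγ 1, hQ⟩
  have := hrep.smul (mul_ne_zero hd (inv_ne_zero hK0))
  convert this using 1
  funext a
  rw [hxd, Pi.smul_apply, Pi.smul_apply, smul_eq_mul, smul_eq_mul, key a]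
  field_simp

theorem JoinedOver.start {z : unitInterval → ℂ × ℂ} {P Q : Curve} (h : JoinedOver z P Q) :
    ∃ x, Represents x P ∧ ∀ a b, x a ^ 2 * squareForm b (z 0).1 (z 0).2 =
      x b ^ 2 * squareForm a (z 0).1 (z 0).2 := by
  obtain ⟨γ, hγ, hover, hP, hQ⟩ := h
  exact ⟨γ 0, ⟨hγ 0, hP⟩, cross_mul (hover 0).1 (hover 0).2⟩

/-! ### Square roots of the branch forms -/

theorem zeta_pow_eq (n : ℕ) : zeta ^ n =
    Real.cos (n * (Real.pi / 5)) + Real.sin (n * (Real.pi / 5)) * Complex.I := by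
  rw [zeta, ← Complex.exp_nat_mul, Complex.ofReal_cos, Complex.ofReal_sin, ← Complex.exp_mul_I]
  congr 1
  push_cast
  ring

theorem zeta_pow_ne_one {n : ℕ} (h : ¬ 10 ∣ n) : zeta ^ n ≠ 1 :=
  fun h1 => h ((isPrimitiveRoot_zeta.pow_eq_one_iff_dvd n).mp h1)

theorem norm_zeta_pow (n : ℕ) : ‖zeta ^ n‖ = 1 := by
  have h : ‖zeta‖ = 1 := by
    rw [zeta, show (2 * Real.pi * Complex.I / 10 : ℂ) = ((2 * Real.pi / 10 : ℝ) : ℂ) * Complex.I by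
      push_cast; ring, Complex.norm_exp_ofReal_mul_I]
  rw [norm_pow, h, one_pow]

theorem sqrt_sq (z : ℂ) : Complex.sqrt z ^ 2 = z := by
  unfold Complex.sqrt
  exact_mod_cast Complex.cpow_nat_inv_pow z two_ne_zero

theorem sqrt_eq_of_sq {z c : ℂ} (h : c ^ 2 = z) (hc : 0 < c.re) : Complex.sqrt z = c := by
  rw [← h]
  exact Complex.sq_cpow_two_inv hc

theorem sqrt_ne_zero {z : ℂ} (h : z ≠ 0) : Complex.sqrt z ≠ 0 := by
  intro h0
  have := sqrt_sq z
  rw [h0, zero_pow two_ne_zero] at this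
  exact h this.symm

/-- The segment from `1` to `-c`, for `c ≠ 1` on the unit circle, avoids the cut of the square root. -/
theorem edge_segment {c : ℂ} (h : ‖c‖ = 1) (h1 : c ≠ 1) (t : unitInterval) :
    0 < ((1 - (t : ℝ) : ℂ) - (t : ℝ) * c).re ∨ ((1 - (t : ℝ) : ℂ) - (t : ℝ) * c).im ≠ 0 := by
  by_contra! hc
  obtain ⟨hre, him⟩ := hc
  simp only [Complex.sub_re, Complex.sub_im, Complex.one_re, Complex.one_im, Complex.ofReal_re,
    Complex.ofReal_im, Complex.re_ofReal_mul, Complex.im_ofReal_mul] at hre him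
  have ht := t.2
  rw [Set.mem_Icc] at ht
  rcases eq_or_ne (t : ℝ) 0 with h0 | h0
  · rw [h0] at hre; norm_num at hre
  have hi : c.im = 0 := by
    have : (t : ℝ) * c.im = 0 := by linarith
    exact (mul_eq_zero.mp this).resolve_left h0
  have hn : c.re ^ 2 = 1 := by
    have := Complex.sq_norm c
    rw [h, Complex.normSq_apply, hi] at this
    nlinarith
  rcases mul_self_eq_one_iff.mp ((sq _).symm.trans hn) with hr | hr
  · exact h1 (Complex.ext (by simp [hr]) (by simp [hi]))
  · rw [hr] at hre
    linarith

/-- The segment from `1` to `1 - c`, for `c` on the unit circle, avoids the negative axis. -/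
theorem center_segment {c : ℂ} (h : ‖c‖ = 1) (t : unitInterval) : 0 ≤ (1 - (t : ℝ) * c).re := by
  have h1 := Complex.re_le_norm ((t : ℝ) * c)
  have ht := t.2
  rw [Set.mem_Icc] at ht
  rw [norm_mul, h, mul_one, Complex.norm_real, Real.norm_of_nonneg ht.1] at h1
  rw [Complex.sub_re, Complex.one_re]
  linarith

theorem center_segment_ne_zero {c : ℂ} (h : ‖c‖ = 1) (h1 : c ≠ 1) (t : unitInterval) :
    1 - (t : ℝ) * c ≠ 0 := by
  intro h0
  have h2 : ((t : ℝ) : ℂ) * c = 1 := by linear_combination -h0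
  have h3 := congrArg norm h2
  rw [norm_mul, h, mul_one, Complex.norm_real, Real.norm_of_nonneg t.2.1, norm_one] at h3
  rw [h3] at h2
  exact h1 (by simpa using h2)

end Adinkra

namespace Adinkra

open scoped ComplexConjugate

/-! ### Principal square roots at the ends of the rays -/

theorem zeta_pow_congr {m n : ℕ} (h : m % 10 = n % 10) : zeta ^ m = zeta ^ n := by
  rw [← Nat.div_add_mod m 10, ← Nat.div_add_mod n 10, pow_add, pow_add, pow_mul, pow_mul,
    zeta_pow_ten, one_pow, one_pow, h]

theorem neg_zeta_pow (n : ℕ) : (-zeta) ^ n = zeta ^ (6 * n) := by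
  rw [show -zeta = zeta ^ 6 by linear_combination -zeta * zeta_pow_five, ← pow_mul]

/-- The exponents of the edge factors. -/
def edgeExponent (j a : Color) : ℕ := (if j = a ∨ j = a + 2 then 5 else 0) + 24 * a.val

theorem edgeFactor_eq (j a : Color) : edgeFactor j a = zeta ^ edgeExponent j a := by
  unfold edgeFactor edgeExponent
  rw [neg_zeta_pow, pow_add, ← mul_assoc, show 6 * 4 = 24 from rfl]
  split_ifs
  · rw [zeta_pow_five]
  · rw [pow_zero]

theorem zeta_pow_re_pos {n : ℕ} (h : n % 10 = 0 ∨ n % 10 = 1 ∨ n % 10 = 2 ∨ n % 10 = 8 ∨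
    n % 10 = 9) : 0 < (zeta ^ n).re := by
  have hre : ∀ k : ℕ, (zeta ^ k).re = Real.cos (k * (Real.pi / 5)) := by
    intro k
    rw [zeta_pow_eq]
    simp only [Complex.add_re, Complex.ofReal_re, Complex.mul_re, Complex.ofReal_im, Complex.I_re,
      Complex.I_im, mul_zero, zero_mul, sub_self, add_zero]
  have hpi := Real.pi_pos
  have key : ∀ x : ℝ, 0 ≤ x → x ≤ 2 → 0 < Real.cos (x * (Real.pi / 5)) := by
    intro x h0 h2
    refine Real.cos_pos_of_mem_Ioo ⟨?_, ?_⟩ <;> nlinarith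
  rw [zeta_pow_congr (Nat.mod_mod n 10).symm, hre]
  rcases h with h | h | h | h | h <;> rw [h]
  · exact key _ (by norm_num) (by norm_num)
  · exact key _ (by norm_num) (by norm_num)
  · exact key _ (by norm_num) (by norm_num)
  · rw [← Real.cos_two_pi_sub, show 2 * Real.pi - (8 : ℕ) * (Real.pi / 5) = 2 * (Real.pi / 5) by
      push_cast; ring]
    exact key _ (by norm_num) (by norm_num)
  · rw [← Real.cos_two_pi_sub, show 2 * Real.pi - (9 : ℕ) * (Real.pi / 5) = 1 * (Real.pi / 5) by
      push_cast; ring]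
    exact key _ (by norm_num) (by norm_num)

theorem I_mul_zeta_pow_re_pos {n : ℕ} (h : 5 < n % 10) : 0 < (Complex.I * zeta ^ n).re := by
  have him : (Complex.I * zeta ^ n).re = -(zeta ^ (n % 10)).im := by
    rw [zeta_pow_congr (Nat.mod_mod n 10)]
    simp
  have hpi := Real.pi_pos
  have hlt : n % 10 < 10 := Nat.mod_lt _ (by norm_num)
  rw [him, zeta_pow_eq]
  simp only [Complex.add_im, Complex.ofReal_im, Complex.mul_im, Complex.ofReal_re, Complex.I_im,
    Complex.I_re, mul_one, mul_zero, add_zero, zero_add]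
  rw [← Real.sin_neg, ← Real.sin_add_two_pi]
  have h1 : (6 : ℝ) ≤ (n % 10 : ℕ) := by exact_mod_cast h
  have h2 : ((n % 10 : ℕ) : ℝ) ≤ 9 := by exact_mod_cast Nat.le_of_lt_succ hlt
  refine Real.sin_pos_of_pos_of_lt_pi ?_ ?_ <;> nlinarith

/-- The value at the end of an edge of the square root that is `1` at its start. -/
theorem sqrt_edge (j a : Color) :
    Complex.sqrt (-zeta ^ (2 * j.val + (13 - 2 * a.val))) =
      (-zeta) ^ (j.val + 4) * edgeFactor j a := by
  rw [neg_zeta_pow, edgeFactor_eq, ← pow_add]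
  refine sqrt_eq_of_sq ?_ (zeta_pow_re_pos ?_)
  · rw [← pow_mul, show -zeta ^ (2 * j.val + (13 - 2 * a.val)) =
      zeta ^ (2 * j.val + (13 - 2 * a.val) + 5) by rw [pow_add _ _ 5, zeta_pow_five]; ring]
    refine zeta_pow_congr ?_
    revert j a
    unfold edgeExponent
    decide
  · revert j a
    unfold edgeExponent
    decide

/-- The exponents of the roots of unity in the branch forms along the bisectors. -/
def centerExponent (j a : Color) : ℕ := 2 * j.val + 1 + (13 - 2 * a.val)

theorem ten_dvd_centerExponent : ∀ j a : Color, 10 ∣ centerExponent j a ↔ a = j + 2 := by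
  unfold centerExponent
  decide

/-- The factor by which the coordinate `a` changes from a black vertex to the centre of a face. -/
noncomputable def blackCenter (j a : Color) : ℂ := Complex.sqrt (1 - zeta ^ centerExponent j a)

/-- The factor by which the coordinate `a` changes from a white vertex to the centre of a face. -/
noncomputable def whiteCenter (j a : Color) : ℂ :=
  Complex.sqrt (1 - zeta ^ (9 * centerExponent j a))

theorem blackCenter_eq_zero (j : Color) : blackCenter j (j + 2) = 0 := by
  obtain ⟨n, hn⟩ := (ten_dvd_centerExponent j (j + 2)).mpr rfl
  rw [blackCenter, hn, pow_mul, zeta_pow_ten, one_pow, sub_self, Complex.sqrt_zero]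

theorem whiteCenter_eq_zero (j : Color) : whiteCenter j (j + 2) = 0 := by
  obtain ⟨n, hn⟩ := (ten_dvd_centerExponent j (j + 2)).mpr rfl
  rw [whiteCenter, hn, show 9 * (10 * n) = 10 * (9 * n) by ring, pow_mul, zeta_pow_ten, one_pow,
    sub_self, Complex.sqrt_zero]

theorem not_ten_dvd_nine_mul {n : ℕ} (h : ¬ 10 ∣ n) : ¬ 10 ∣ 9 * n := by omega

/-- The principal square roots of a number and of its conjugate. -/
theorem sqrt_eq_mul_sqrt_conj {z u : ℂ} (hz : 0 < z.re) (hu : 0 < u.re) (h : u ^ 2 * conj z = z) :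
    Complex.sqrt z = u * Complex.sqrt (conj z) := by
  have harg : z.arg ≠ Real.pi := by
    intro h
    rw [Complex.arg_eq_pi_iff] at h
    linarith [h.1]
  have hconj : Complex.sqrt (conj z) = conj (Complex.sqrt z) := by
    unfold Complex.sqrt
    rw [Complex.conj_cpow z _ harg, map_inv₀, Complex.conj_ofNat]
  rw [hconj]
  have hsq : Complex.sqrt z * Complex.sqrt z =
      (u * conj (Complex.sqrt z)) * (u * conj (Complex.sqrt z)) := by
    have h1 := sqrt_sq z
    have h2 : conj (Complex.sqrt z) ^ 2 = conj z := by rw [← map_pow, h1]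
    linear_combination h1 - h - u ^ 2 * h2
  -- The wrong sign would give `z = -u |√z|²`, whose real part is not positive.
  rcases mul_self_eq_mul_self_iff.mp hsq with h1 | h1
  · exact h1
  exfalso
  have h2 : z = -u * (Complex.normSq (Complex.sqrt z) : ℂ) := by
    rw [← Complex.mul_conj]
    linear_combination -sqrt_sq z + Complex.sqrt z * h1
  have h3 := congrArg Complex.re h2
  rw [Complex.re_mul_ofReal, Complex.neg_re] at h3
  nlinarith [Complex.normSq_nonneg (Complex.sqrt z), mul_nonneg hu.le
    (Complex.normSq_nonneg (Complex.sqrt z))]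

theorem five_lt_exponent : ∀ j a : Color, a ≠ j + 2 →
    5 < (6 * (j.val + 2) + edgeExponent j a) % 10 := by
  unfold edgeExponent
  decide

theorem two_mul_exponent : ∀ j a : Color, a ≠ j + 2 →
    (2 * (6 * (j.val + 2) + edgeExponent j a)) % 10 = centerExponent j a % 10 := by
  unfold edgeExponent centerExponent
  decide

/-- A centre must be the same point whether reached from the black or from the white end of an edge;
the scalar on the right is independent of `a`. The source is `1 - ζ^m = -ζ^m (1 - ζ^{-m})`, with
conjugate arguments of the two square roots. -/
theorem edgeFactor_mul_whiteCenter (j a : Color) :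
    edgeFactor j a * whiteCenter j a =
      (-Complex.I * zeta ^ (4 * (j.val + 2))) * blackCenter j a := by
  by_cases ha : a = j + 2
  · rw [ha, whiteCenter_eq_zero, blackCenter_eq_zero, mul_zero, mul_zero]
  have hm : ¬ 10 ∣ centerExponent j a := fun h => ha ((ten_dvd_centerExponent j a).mp h)
  set m := centerExponent j a with hm'
  have hone := zeta_pow_ne_one hm
  have hnorm := norm_zeta_pow m
  have hconj : conj (1 - zeta ^ m) = 1 - zeta ^ (9 * m) := by
    have h1 : zeta ^ m * conj (zeta ^ m) = 1 := by
      rw [Complex.mul_conj, Complex.normSq_eq_norm_sq, hnorm]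
      simp
    have h2 : zeta ^ m * zeta ^ (9 * m) = 1 := by
      rw [← pow_add, show m + 9 * m = 10 * m by ring, pow_mul, zeta_pow_ten, one_pow]
    rw [map_sub, map_one, mul_left_cancel₀ (pow_ne_zero m zeta_ne_zero) (h1.trans h2.symm)]
  have hre : 0 < (1 - zeta ^ m).re := by
    have h1 := Complex.re_le_norm (zeta ^ m)
    rw [hnorm] at h1
    rw [Complex.sub_re, Complex.one_re, sub_pos]
    refine lt_of_le_of_ne h1 fun h2 => hone (Complex.ext h2 ?_)
    have h3 := Complex.sq_norm (zeta ^ m)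
    rw [hnorm, Complex.normSq_apply, h2] at h3
    simpa using h3
  have hu : 0 < (Complex.I * zeta ^ (6 * (j.val + 2) + edgeExponent j a)).re := by
    exact I_mul_zeta_pow_re_pos (five_lt_exponent j a ha)
  have hsq : (Complex.I * zeta ^ (6 * (j.val + 2) + edgeExponent j a)) ^ 2 * conj (1 - zeta ^ m) =
      1 - zeta ^ m := by
    have h1 : zeta ^ (2 * (6 * (j.val + 2) + edgeExponent j a)) = zeta ^ m :=
      zeta_pow_congr (two_mul_exponent j a ha)
    have h2 : zeta ^ m * zeta ^ (9 * m) = 1 := by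
      rw [← pow_add, show m + 9 * m = 10 * m by ring, pow_mul, zeta_pow_ten, one_pow]
    rw [hconj, mul_pow, Complex.I_sq, ← pow_mul, mul_comm _ 2, h1]
    linear_combination h2
  have key := sqrt_eq_mul_sqrt_conj hre hu hsq
  rw [blackCenter, whiteCenter, ← hm', key, hconj, edgeFactor_eq, pow_add]
  have h10 : zeta ^ (4 * (j.val + 2)) * zeta ^ (6 * (j.val + 2)) = 1 := by
    rw [← pow_add, show 4 * (j.val + 2) + 6 * (j.val + 2) = 10 * (j.val + 2) by ring, pow_mul,
      zeta_pow_ten, one_pow]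
  linear_combination (Complex.I ^ 2 * zeta ^ edgeExponent j a *
    Complex.sqrt (1 - zeta ^ (9 * m))) * h10 + zeta ^ edgeExponent j a *
    Complex.sqrt (1 - zeta ^ (9 * m)) * Complex.I_sq

/-! ### Reference lifts -/

/-- Square roots of the branch forms along an edge. -/
noncomputable def edgeLift (j : Color) (t : unitInterval) (a : Color) : ℂ :=
  Complex.sqrt ((1 - (t : ℝ)) - (t : ℝ) * zeta ^ (2 * j.val + (13 - 2 * a.val)))

/-- Square roots of the branch forms along a bisector from a black vertex. -/
noncomputable def blackLift (j : Color) (t : unitInterval) (a : Color) : ℂ :=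
  Complex.sqrt (1 - (t : ℝ) * zeta ^ centerExponent j a)

/-- Square roots of the branch forms along a bisector from a white vertex. -/
noncomputable def whiteLift (j : Color) (t : unitInterval) (a : Color) : ℂ :=
  Complex.sqrt (1 - (t : ℝ) * zeta ^ (9 * centerExponent j a))

theorem edgeExponent_ne_one (j a : Color) : zeta ^ (2 * j.val + (13 - 2 * a.val)) ≠ 1 :=
  zeta_pow_ne_one (by revert j a; decide)

theorem continuous_edgeLift (j : Color) : Continuous (edgeLift j) := by
  refine continuous_pi fun a => continuous_iff_continuousAt.mpr fun t => ?_
  refine ContinuousAt.comp (g := Complex.sqrt) (Complex.continuousAt_sqrt ?_) (by fun_prop)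
  exact (edge_segment (norm_zeta_pow _) (edgeExponent_ne_one j a) t).imp_left le_of_lt

theorem continuous_blackLift (j : Color) : Continuous (blackLift j) := by
  refine continuous_pi fun a => continuous_iff_continuousAt.mpr fun t => ?_
  refine ContinuousAt.comp (g := Complex.sqrt) (Complex.continuousAt_sqrt ?_) (by fun_prop)
  -- The segment may end at `0`, where the principal square root is still continuous.
  exact .inl (center_segment (norm_zeta_pow _) t)

theorem continuous_whiteLift (j : Color) : Continuous (whiteLift j) := by
  refine continuous_pi fun a => continuous_iff_continuousAt.mpr fun t => ?_
  refine ContinuousAt.comp (g := Complex.sqrt) (Complex.continuousAt_sqrt ?_) (by fun_prop)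
  exact .inl (center_segment (norm_zeta_pow _) t)

theorem edgeLift_ne_zero (j : Color) (t : unitInterval) (a : Color) : edgeLift j t a ≠ 0 := by
  refine sqrt_ne_zero fun h => ?_
  have := edge_segment (norm_zeta_pow _) (edgeExponent_ne_one j a) t
  rw [h] at this
  simp at this

theorem blackLift_ne_zero {j a : Color} (ha : a ≠ j + 2) (t : unitInterval) :
    blackLift j t a ≠ 0 :=
  sqrt_ne_zero (center_segment_ne_zero (norm_zeta_pow _)
    (zeta_pow_ne_one fun h => ha ((ten_dvd_centerExponent j a).mp h)) t)

theorem whiteLift_ne_zero {j a : Color} (ha : a ≠ j + 2) (t : unitInterval) :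
    whiteLift j t a ≠ 0 :=
  sqrt_ne_zero (center_segment_ne_zero (norm_zeta_pow _)
    (zeta_pow_ne_one (not_ten_dvd_nine_mul fun h => ha ((ten_dvd_centerExponent j a).mp h))) t)

theorem edgeLift_zero (j a : Color) : edgeLift j 0 a = 1 := by simp [edgeLift]

theorem blackLift_zero (j a : Color) : blackLift j 0 a = 1 := by simp [blackLift]

theorem whiteLift_zero (j a : Color) : whiteLift j 0 a = 1 := by simp [whiteLift]

theorem edgeLift_one (j a : Color) : edgeLift j 1 a = (-zeta) ^ (j.val + 4) * edgeFactor j a := by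
  rw [← sqrt_edge]; simp [edgeLift]

theorem blackLift_one (j a : Color) : blackLift j 1 a = blackCenter j a := by
  simp [blackLift, blackCenter]

theorem whiteLift_one (j a : Color) : whiteLift j 1 a = whiteCenter j a := by
  simp [whiteLift, whiteCenter]

theorem edgeLift_sq (j : Color) (t : unitInterval) (a : Color) :
    edgeLift j t a ^ 2 = 1 * branchForm a (edgeRay j t).1 (edgeRay j t).2 := by
  rw [edgeLift, sqrt_sq, branchForm, edgeRay, pow_add]
  ring

theorem blackLift_sq (j : Color) (t : unitInterval) (a : Color) :
    blackLift j t a ^ 2 = 1 * branchForm a (blackRay j t).1 (blackRay j t).2 := by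
  rw [blackLift, sqrt_sq, branchForm, blackRay, centerExponent, pow_add _ (2 * j.val + 1)]
  ring

theorem whiteLift_sq (j : Color) (t : unitInterval) (a : Color) :
    whiteLift j t a ^ 2 =
      -zeta ^ (9 * centerExponent j a) * branchForm a (whiteRay j t).1 (whiteRay j t).2 := by
  have h : zeta ^ (9 * centerExponent j a) * zeta ^ centerExponent j a = 1 := by
    rw [← pow_add, show 9 * centerExponent j a + centerExponent j a = 10 * centerExponent j a by
      ring, pow_mul, zeta_pow_ten, one_pow]
  rw [whiteLift, sqrt_sq, branchForm, whiteRay, ← pow_add, ← centerExponent]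
  linear_combination -h

theorem JoinedOver.edge_transport {j : Color} {P Q : Curve} (h : JoinedOver (edgeRay j) P Q)
    {x : Color → ℂ} (hx : Represents x P) : Represents (fun a => x a * edgeFactor j a) Q := by
  have h1 := h.transport (continuous_edgeLift j) (c := fun _ => 1) (fun _ => one_ne_zero)
    (edgeLift_sq j) (fun a => .inl fun t => edgeLift_ne_zero j t a)
    (fun t => edgeLift_ne_zero j t 0) hx
  -- The factor common to all coordinates is projectively irrelevant.
  have h2 := h1.smul (c := ((-zeta) ^ (j.val + 4))⁻¹)
    (inv_ne_zero (pow_ne_zero _ (neg_ne_zero.mpr zeta_ne_zero)))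
  convert h2 using 1
  funext a
  have := pow_ne_zero (j.val + 4) (neg_ne_zero.mpr zeta_ne_zero)
  rw [Pi.smul_apply, smul_eq_mul, edgeLift_one, edgeLift_zero]
  field_simp

theorem JoinedOver.black_transport {j : Color} {P Q : Curve} (h : JoinedOver (blackRay j) P Q)
    {x : Color → ℂ} (hx : Represents x P) : Represents (fun a => x a * blackCenter j a) Q := by
  have h1 := h.transport (continuous_blackLift j) (c := fun _ => 1) (fun _ => one_ne_zero)
    (blackLift_sq j) (fun a => ?_) (blackLift_ne_zero (a := j) (by simp)) hx
  · simpa only [blackLift_one, blackLift_zero, div_one] using h1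
  · by_cases ha : a = j + 2
    · right
      rw [ha, blackLift_one, blackCenter_eq_zero]
    · exact .inl (blackLift_ne_zero ha)

theorem JoinedOver.white_transport {j : Color} {P Q : Curve} (h : JoinedOver (whiteRay j) P Q)
    {x : Color → ℂ} (hx : Represents x P) : Represents (fun a => x a * whiteCenter j a) Q := by
  have h1 := h.transport (continuous_whiteLift j)
    (c := fun a => -zeta ^ (9 * centerExponent j a))
    (fun _ => neg_ne_zero.mpr (pow_ne_zero _ zeta_ne_zero))
    (whiteLift_sq j) (fun a => ?_) (whiteLift_ne_zero (a := j) (by simp)) hx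
  · simpa only [whiteLift_one, whiteLift_zero, div_one] using h1
  · by_cases ha : a = j + 2
    · right
      rw [ha, whiteLift_one, whiteCenter_eq_zero]
    · exact .inl (whiteLift_ne_zero ha)

end Adinkra

namespace Adinkra

/-! ### Embeddings are configurations -/

/-- The squares of the homogeneous coordinates of `p` are proportional to `c`. -/
def HasSquares (c : Color → ℂ) (p : Curve) : Prop :=
  ∃ x ρ, Represents x p ∧ ρ ≠ 0 ∧ ∀ a, x a ^ 2 = ρ * c a

/-- The squares of the homogeneous coordinates of the white vertices. -/
noncomputable def whiteWeight (a : Color) : ℂ := weight a * zeta ^ (8 * a.val)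

theorem whiteWeight_ne_zero (a : Color) : whiteWeight a ≠ 0 :=
  mul_ne_zero (weight_ne_zero a) (pow_ne_zero _ zeta_ne_zero)

theorem HasSquares.of_represents {c : Color → ℂ} {p : Curve} (h : HasSquares c p) {x : Color → ℂ}
    (hx : Represents x p) : ∃ ρ, ρ ≠ 0 ∧ ∀ a, x a ^ 2 = ρ * c a := by
  obtain ⟨y, ρ, hy, hρ, hsq⟩ := h
  obtain ⟨d, hd, rfl⟩ := hy.exists_smul hx
  refine ⟨d ^ 2 * ρ, mul_ne_zero (pow_ne_zero 2 hd) hρ, fun a => ?_⟩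
  rw [Pi.smul_apply, smul_eq_mul, mul_pow, hsq, mul_assoc]

theorem HasSquares.black_ne_white {p : Curve} (h : HasSquares weight p) :
    ¬ HasSquares whiteWeight p := by
  rintro ⟨x, ρ, hx, hρ, hsq⟩
  obtain ⟨σ, hσ, hsq'⟩ := h.of_represents hx
  have h0 := (hsq 0).symm.trans (hsq' 0)
  have h1 := (hsq 1).symm.trans (hsq' 1)
  have w0 := weight_ne_zero 0
  have w1 := weight_ne_zero 1
  have e0 : ρ = σ := by
    simpa [whiteWeight, w0] using h0
  have e1 : ρ * zeta ^ 8 = σ := by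
    refine mul_right_cancel₀ w1 ?_
    rw [← h1, whiteWeight]
    change _ = ρ * (weight 1 * zeta ^ 8)
    ring
  refine zeta_pow_ne_one (n := 8) (by norm_num) (mul_left_cancel₀ hρ ?_)
  rw [e1, mul_one, e0]

theorem HasSquares.of_cross {c x : Color → ℂ} {p : Curve} (hc : ∀ a, c a ≠ 0)
    (hx : Represents x p) (h : ∀ a b, x a ^ 2 * c b = x b ^ 2 * c a) : HasSquares c p := by
  have hsq : ∀ a, x a ^ 2 = x 0 ^ 2 / c 0 * c a := fun a => by
    rw [div_mul_eq_mul_div, eq_div_iff (hc 0), h]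
  refine ⟨x, x 0 ^ 2 / c 0, hx, fun h0 => hx.ne_zero (funext fun a => ?_), hsq⟩
  have := hsq a
  rw [h0, zero_mul] at this
  exact pow_eq_zero_iff two_ne_zero |>.mp this

theorem squareForm_black (a : Color) : squareForm a 0 1 = weight a := by
  rw [squareForm, branchForm]
  ring

theorem squareForm_white (a : Color) (u : ℂ) :
    squareForm a u 0 = -(u * zeta ^ 3) * whiteWeight a := by
  have h : zeta ^ (13 - 2 * a.val) = zeta ^ 3 * zeta ^ (8 * a.val) := by
    rw [← pow_add]
    exact zeta_pow_congr (by revert a; decide)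
  rw [squareForm, branchForm, whiteWeight, h]
  ring

theorem JoinedOver.black_start {z : unitInterval → ℂ × ℂ} {P Q : Curve} (h : JoinedOver z P Q)
    (hz : z 0 = (0, 1)) : HasSquares weight P := by
  obtain ⟨x, hx, hc⟩ := h.start
  refine .of_cross weight_ne_zero hx fun a b => ?_
  simpa only [hz, squareForm_black] using hc a b

theorem JoinedOver.white_start {z : unitInterval → ℂ × ℂ} {P Q : Curve} (h : JoinedOver z P Q)
    {u : ℂ} (hu : u ≠ 0) (hz : z 0 = (u, 0)) : HasSquares whiteWeight P := by
  obtain ⟨x, hx, hc⟩ := h.start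
  refine .of_cross whiteWeight_ne_zero hx fun a b => ?_
  have := hc a b
  simp only [hz, squareForm_white] at this
  refine mul_left_cancel₀ (neg_ne_zero.mpr (mul_ne_zero hu (pow_ne_zero 3 zeta_ne_zero))) ?_
  linear_combination this

theorem edgeRay_zero (j : Color) : edgeRay j 0 = (0, 1) := by simp [edgeRay]

theorem blackRay_zero (j : Color) : blackRay j 0 = (0, 1) := by simp [blackRay]

theorem whiteRay_zero (j : Color) : whiteRay j 0 = (zeta ^ (2 * j.val + 1), 0) := by
  simp [whiteRay]

theorem edgePair_of_joinedOver {j : Color} {P Q : Curve} (h : JoinedOver (edgeRay j) P Q) :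
    EdgePair j P Q := by
  obtain ⟨x, ρ, hx, hρ, hsq⟩ := h.black_start (edgeRay_zero j)
  exact ⟨x, _, ρ, hx, h.edge_transport hx, hρ, hsq, fun _ => rfl⟩

theorem edge_white_end {j : Color} {P Q : Curve} (h : JoinedOver (edgeRay j) P Q) :
    HasSquares whiteWeight Q := by
  obtain ⟨x, ρ, hx, hρ, hsq⟩ := h.black_start (edgeRay_zero j)
  refine ⟨_, ρ, h.edge_transport hx, hρ, fun a => ?_⟩
  rw [mul_pow, hsq, edgeFactor_sq, whiteWeight, mul_assoc]

theorem JoinedOver.edge_transport_reverse {j : Color} {P Q : Curve}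
    (h : JoinedOver (edgeRay j) P Q) {y : Color → ℂ} (hy : Represents y Q) :
    Represents (fun a => y a * (edgeFactor j a)⁻¹) P := by
  obtain ⟨x, -, hx, -⟩ := h.black_start (edgeRay_zero j)
  obtain ⟨d, hd, rfl⟩ := (h.edge_transport hx).exists_smul hy
  convert hx.smul hd using 1
  funext a
  have := edgeFactor_ne_zero j a
  simp only [Pi.smul_apply, smul_eq_mul]
  field_simp

/-- No point lies over both `0` and `∞`. One bisector at `v` decides which occurs, and this forces
the direction of every edge and bisector at `v`. -/
theorem Embedding.dichotomy (ε : Embedding) (v : Vertex) :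
    (HasSquares weight (ε.vertex v) ∧
      (∀ j, JoinedOver (edgeRay j) (ε.vertex v) (ε.vertex (nbr v j))) ∧
      ∀ j, JoinedOver (blackRay j) (ε.vertex v) (ε.center (face j v))) ∨
    (HasSquares whiteWeight (ε.vertex v) ∧
      (∀ j, JoinedOver (edgeRay j) (ε.vertex (nbr v j)) (ε.vertex v)) ∧
      ∀ j, JoinedOver (whiteRay j) (ε.vertex v) (ε.center (face j v))) := by
  have hw : ∀ j, JoinedOver (whiteRay j) (ε.vertex v) (ε.center (face j v)) →
      HasSquares whiteWeight (ε.vertex v) := fun j h =>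
    h.white_start (pow_ne_zero _ zeta_ne_zero) (whiteRay_zero j)
  have hb : ∀ j, JoinedOver (blackRay j) (ε.vertex v) (ε.center (face j v)) →
      HasSquares weight (ε.vertex v) := fun j h => h.black_start (blackRay_zero j)
  rcases ε.center_adj v 0 with h | h
  · have hv := hb 0 h
    exact .inl ⟨hv, fun j => (ε.edge v j).resolve_right fun h => hv.black_ne_white
      (edge_white_end h), fun j => (ε.center_adj v j).resolve_right fun h =>
        hv.black_ne_white (hw j h)⟩
  · have hv := hw 0 h
    exact .inr ⟨hv, fun j => (ε.edge v j).resolve_left fun h =>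
      (h.black_start (edgeRay_zero j)).black_ne_white hv,
      fun j => (ε.center_adj v j).resolve_left fun h => (hb j h).black_ne_white hv⟩

/-- The negated coordinates are `j, j-2` for colour `j` and `j+1, j-1` for colour `j+1`; together
they exhaust all but `j+2`. Up to a global sign, only `x_{j+2}` flips. -/
theorem edgeFactor_succ (j a : Color) :
    edgeFactor (j + 1) a = if a = j + 2 then edgeFactor j a else -edgeFactor j a := by
  have h : ∀ j a : Color, ((j + 1 = a ∨ j + 1 = a + 2) ↔ (j = a ∨ j = a + 2)) ↔ a = j + 2 := by
    decide
  specialize h j a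
  unfold edgeFactor
  split_ifs <;> first | ring1 | (exfalso; tauto)

theorem Flipped.hasSquares {b : Color} {p q : Curve} (h : Flipped b p q) {c : Color → ℂ}
    (hp : HasSquares c p) : HasSquares c q := by
  obtain ⟨x, y, hx, hy, hxy⟩ := h
  obtain ⟨ρ, hρ, hsq⟩ := hp.of_represents hx
  refine ⟨y, ρ, hy, hρ, fun a => ?_⟩
  rw [hxy, ← hsq]
  split_ifs
  · exact neg_sq _
  · rfl

theorem Flipped.mul {b : Color} {p q p' q' : Curve} (h : Flipped b p q) {f : Color → ℂ}
    (hp : ∀ x, Represents x p → Represents (fun a => x a * f a) p')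
    (hq : ∀ x, Represents x q → Represents (fun a => x a * f a) q') : Flipped b p' q' := by
  obtain ⟨x, y, hx, hy, hxy⟩ := h
  refine ⟨_, _, hp x hx, hq y hy, fun a => ?_⟩
  rw [hxy]
  split_ifs
  · exact neg_mul _ _
  · rfl

theorem Embedding.flip_vertex (ε : Embedding) (v : Vertex) (j : Color) :
    Flipped (j + 2) (ε.vertex (nbr v j)) (ε.vertex (nbr v (j + 1))) := by
  rcases ε.dichotomy v with ⟨⟨x, -, hx, -⟩, he, -⟩ | ⟨⟨x, -, hx, -⟩, he, -⟩
  · refine ⟨_, _, (he j).edge_transport hx,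
      ((he (j + 1)).edge_transport hx).smul (neg_ne_zero.mpr one_ne_zero), fun a => ?_⟩
    simp only [Pi.smul_apply, smul_eq_mul, edgeFactor_succ]
    split_ifs <;> ring
  · refine ⟨_, _, (he j).edge_transport_reverse hx,
      ((he (j + 1)).edge_transport_reverse hx).smul (neg_ne_zero.mpr one_ne_zero), fun a => ?_⟩
    simp only [Pi.smul_apply, smul_eq_mul, edgeFactor_succ]
    split_ifs
    · ring
    · rw [inv_neg]; ring

theorem Embedding.configuration (ε : Embedding) : Configuration ε.vertex ε.center where
  edge v j := (ε.edge v j).imp edgePair_of_joinedOver edgePair_of_joinedOver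
  flip_vertex := ε.flip_vertex
  flip_center v i j := by
    -- Both `v` and the opposite corner are neighbours of `nbr v j`; they have the same type, so the
    -- same factors carry their sign flip to the centres.
    have h := ε.flip_vertex (nbr v j) j
    rw [nbr_nbr_self] at h
    rcases ε.dichotomy v with ⟨hv, -, hc⟩ | ⟨hv, -, hc⟩ <;>
      rcases ε.dichotomy (nbr (nbr v j) (j + 1)) with ⟨hv', -, hc'⟩ | ⟨hv', -, hc'⟩
    · exact h.mul (fun x => (hc i).black_transport) (fun x => (hc' i).black_transport)
    · exact absurd hv' (h.hasSquares hv).black_ne_white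
    · exact absurd (h.hasSquares hv) hv'.black_ne_white
    · exact h.mul (fun x => (hc i).white_transport) (fun x => (hc' i).white_transport)
  center_zero v j := by
    rcases ε.dichotomy v with ⟨⟨x, -, hx, -⟩, -, hc⟩ | ⟨⟨x, -, hx, -⟩, -, hc⟩
    · exact ⟨_, (hc j).black_transport hx, by rw [blackCenter_eq_zero, mul_zero]⟩
    · exact ⟨_, (hc j).white_transport hx, by rw [whiteCenter_eq_zero, mul_zero]⟩

end Adinkra

namespace Adinkra

/-! ### Existence of an embedding -/

theorem exists_represents {x : Color → ℂ} (hx : x ≠ 0) (h : OnCurve x) :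
    ∃ P : Curve, Represents x P := by
  obtain ⟨c, hc⟩ := Projectivization.exists_smul_eq_mk_rep ℂ x hx
  exact ⟨⟨Projectivization.mk ℂ x hx, hc ▸ onCurve_smul h (c : ℂ)⟩, hx, rfl⟩

/-- Converse to transport: by `hx` the vectors `x a * δ t a` have squares proportional to
`squareForm`, hence trace a lift. -/
theorem joinedOver_of_lift {z : unitInterval → ℂ × ℂ} {P Q : Curve}
    {δ : unitInterval → Color → ℂ} (hδ : Continuous δ) {c : Color → ℂ}
    (hsq : ∀ t a, δ t a ^ 2 = c a * branchForm a (z t).1 (z t).2) (h0 : ∀ a, δ 0 a = 1)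
    {a₀ : Color} (ha₀ : ∀ t, δ t a₀ ≠ 0) {x : Color → ℂ} {ρ : ℂ} (hx0 : x a₀ ≠ 0)
    (hx : ∀ a, x a ^ 2 * c a = ρ * weight a) (hP : Represents x P)
    (hQ : Represents (fun a => x a * δ 1 a) Q) : JoinedOver z P Q := by
  have hc : Continuous fun t => fun a => x a * δ t a :=
    continuous_pi fun a => continuous_const.mul ((continuous_apply a).comp hδ)
  have hform : ∀ t a, (x a * δ t a) ^ 2 = ρ * squareForm a (z t).1 (z t).2 := fun t a => by
    rw [mul_pow, hsq, squareForm, ← mul_assoc, hx, mul_assoc]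
  refine ⟨⟨_, hc⟩, fun t h => mul_ne_zero hx0 (ha₀ t) (congrFun h a₀), fun t => ⟨?_, ?_⟩, ?_, hQ.2⟩
  · exact onCurve_of_sq (hform t)
  · rw [liesOver_iff]
    simp only [ContinuousMap.coe_mk, hform]
    ring
  · obtain ⟨hx, hP⟩ := hP
    rw [hP]
    congr 1
    funext a
    simp [h0]

/-- The sign attached to an element of `ZMod 2`. -/
noncomputable def sgn (s : ZMod 2) : ℂ := (-1) ^ s.val

theorem sgn_sq (s : ZMod 2) : sgn s ^ 2 = 1 := by
  rw [sgn, ← pow_mul, mul_comm, pow_mul, neg_one_sq, one_pow]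

theorem sgn_ne_zero (s : ZMod 2) : sgn s ≠ 0 := pow_ne_zero _ (by norm_num)

theorem sgn_injective : Function.Injective sgn := by
  intro s t h
  have hs : ∀ s : ZMod 2, s = 0 ∨ s = 1 := by decide
  have h1 : (1 : ℂ) ≠ -1 := by norm_num
  have e0 : sgn 0 = 1 := pow_zero _
  have e1 : sgn 1 = -1 := pow_one _
  rcases hs s with rfl | rfl <;> rcases hs t with rfl | rfl
  · rfl
  · rw [e0, e1] at h; exact absurd h h1
  · rw [e0, e1] at h; exact absurd h.symm h1
  · rfl

theorem sgn_nbr (v : Vertex) (j a : Color) :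
    sgn (nbr v j a) = (if j = a then -1 else 1) * sgn (v a) := by
  by_cases h : j = a
  · subst h
    have hs : ∀ s : ZMod 2, s = 0 ∨ s = 1 := by decide
    have e0 : sgn 0 = 1 := pow_zero _
    have e1 : sgn 1 = -1 := pow_one _
    rw [if_pos rfl, nbr, Pi.add_apply, Pi.single_eq_same]
    rcases hs (v j) with h | h <;> rw [h]
    · rw [zero_add, e0, e1]; norm_num
    · rw [show (1 + 1 : ZMod 2) = 0 from rfl, e0, e1]; norm_num
  · rw [if_neg h, one_mul, nbr, Pi.add_apply, Pi.single_eq_of_ne (Ne.symm h), add_zero]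

theorem prod_sgn (v : Vertex) : ∏ a, sgn (v a) = (-1) ^ heightFE v :=
  Finset.prod_pow_eq_pow_sum _ _ _

theorem even_heightFE_nbr (v : Vertex) (j : Color) :
    Even (heightFE (nbr v j)) ↔ ¬ Even (heightFE v) := by
  rcases eq_or_ne (v j) 0 with h | h
  · rw [heightFE_nbr_of_eq_zero v j h, Nat.even_add_one]
  · rw [← heightFE_nbr_of_ne_zero v j h, Nat.even_add_one, not_not]

/-- Homogeneous coordinates of the image of a vertex. -/
noncomputable def vertexCoord (v : Vertex) (a : Color) : ℂ :=
  Complex.sqrt (weight a) * (sgn (v a) * sgn (v (a + 2))) *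
    (if Even (heightFE v) then 1 else (-zeta) ^ (4 * a.val))

theorem vertexCoord_ne_zero (v : Vertex) (a : Color) : vertexCoord v a ≠ 0 := by
  refine mul_ne_zero (mul_ne_zero (sqrt_ne_zero (weight_ne_zero a))
    (mul_ne_zero (sgn_ne_zero _) (sgn_ne_zero _))) ?_
  split_ifs
  · exact one_ne_zero
  · exact pow_ne_zero _ (neg_ne_zero.mpr zeta_ne_zero)

theorem vertexCoord_sq_even {v : Vertex} (hv : Even (heightFE v)) (a : Color) :
    vertexCoord v a ^ 2 = weight a := by
  rw [vertexCoord, if_pos hv, mul_one, mul_pow, sqrt_sq, mul_pow, sgn_sq, sgn_sq, mul_one, mul_one]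

theorem vertexCoord_sq_odd {v : Vertex} (hv : ¬ Even (heightFE v)) (a : Color) :
    vertexCoord v a ^ 2 = whiteWeight a := by
  rw [vertexCoord, if_neg hv, mul_pow, mul_pow, sqrt_sq, mul_pow, sgn_sq, sgn_sq, mul_one, mul_one,
    ← pow_mul, neg_zeta_pow, whiteWeight]
  congr 1
  exact zeta_pow_congr (by revert a; decide)

theorem vertexCoord_nbr {v : Vertex} (hv : Even (heightFE v)) (j a : Color) :
    vertexCoord (nbr v j) a = vertexCoord v a * edgeFactor j a := by
  have h2 : a ≠ a + 2 := by simp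
  rw [vertexCoord, vertexCoord, if_pos hv, if_neg (by rwa [even_heightFE_nbr, not_not]), sgn_nbr,
    sgn_nbr, edgeFactor]
  by_cases h : j = a
  · rw [if_pos h, if_neg (h ▸ h2), if_pos (.inl h)]; ring
  · by_cases h' : j = a + 2
    · rw [if_neg h, if_pos h', if_pos (.inr h')]; ring
    · rw [if_neg h, if_neg h', if_neg (by tauto)]; ring

theorem vertexCoord_nbr_nbr (v : Vertex) (j a : Color) :
    vertexCoord (nbr (nbr v j) (j + 1)) a =
      if a = j + 2 then vertexCoord v a else -vertexCoord v a := by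
  have hc : ∀ j a : Color, (a = j + 2 ∧ j ≠ a ∧ j ≠ a + 2 ∧ j + 1 ≠ a ∧ j + 1 ≠ a + 2) ∨
      (a ≠ j + 2 ∧ j = a ∧ j ≠ a + 2 ∧ j + 1 ≠ a ∧ j + 1 ≠ a + 2) ∨
      (a ≠ j + 2 ∧ j ≠ a ∧ j = a + 2 ∧ j + 1 ≠ a ∧ j + 1 ≠ a + 2) ∨
      (a ≠ j + 2 ∧ j ≠ a ∧ j ≠ a + 2 ∧ j + 1 = a ∧ j + 1 ≠ a + 2) ∨
      (a ≠ j + 2 ∧ j ≠ a ∧ j ≠ a + 2 ∧ j + 1 ≠ a ∧ j + 1 = a + 2) := by decide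
  simp only [vertexCoord, even_heightFE_nbr, not_not, sgn_nbr]
  rcases hc j a with h | h | h | h | h <;> obtain ⟨h0, h1, h2, h3, h4⟩ := h
  · simp only [if_pos h0, if_neg h1, if_neg h2, if_neg h3, if_neg h4]; ring
  · simp only [if_neg h0, if_pos h1, if_neg h2, if_neg h3, if_neg h4]; ring
  · simp only [if_neg h0, if_neg h1, if_pos h2, if_neg h3, if_neg h4]; ring
  · simp only [if_neg h0, if_neg h1, if_neg h2, if_pos h3, if_neg h4]; ring
  · simp only [if_neg h0, if_neg h1, if_neg h2, if_neg h3, if_pos h4]; ring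

theorem vertexCoord_injective {v w : Vertex} {c : ℂ} (hvw : Even (heightFE v) ↔ Even (heightFE w))
    (h : ∀ a, vertexCoord w a = c * vertexCoord v a) : v = w := by
  have h1 : ∀ a, sgn (w a) * sgn (w (a + 2)) = c * (sgn (v a) * sgn (v (a + 2))) := by
    intro a
    have := h a
    simp only [vertexCoord, hvw] at this
    have hu : (if Even (heightFE w) then (1 : ℂ) else (-zeta) ^ (4 * a.val)) ≠ 0 := by
      split_ifs
      · exact one_ne_zero
      · exact pow_ne_zero _ (neg_ne_zero.mpr zeta_ne_zero)
    refine mul_left_cancel₀ (sqrt_ne_zero (weight_ne_zero a)) (mul_right_cancel₀ hu ?_)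
    linear_combination this
  set t : Color → ℂ := fun a => sgn (v a) * sgn (w a) with ht
  have htsq : ∀ a, t a ^ 2 = 1 := fun a => by rw [ht, mul_pow, sgn_sq, sgn_sq, one_mul]
  have ht0 : ∀ a, t a ≠ 0 := fun a => mul_ne_zero (sgn_ne_zero _) (sgn_ne_zero _)
  have htt : ∀ a, t a * t (a + 2) = c := fun a => by
    simp only [ht]
    linear_combination sgn (v a) * sgn (v (a + 2)) * h1 a + c * sgn (v (a + 2)) ^ 2 *
      sgn_sq (v a) + c * sgn_sq (v (a + 2))
  -- Two steps of `t a * t (a + 2) = c` give period `4`, which generates the indices modulo `5`; so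
  -- `t` is constant. Equal parity makes its product `1`, and `t⁵ = t² = 1` yields `t = 1`.
  have hstep : ∀ a, t (a + 4) = t a := fun a => by
    have e1 := htt a
    have e2 := htt (a + 2)
    rw [add_assoc, show (2 + 2 : Color) = 4 from rfl] at e2
    exact mul_left_cancel₀ (ht0 (a + 2)) (by rw [e2, ← e1, mul_comm])
  have h4 : t 4 = t 0 := hstep 0
  have h3 : t 3 = t 4 := hstep 4
  have h2 : t 2 = t 3 := hstep 3
  have h1' : t 1 = t 2 := hstep 2
  have hprod : ∏ a, t a = 1 := by
    rw [Finset.prod_mul_distrib, prod_sgn, prod_sgn, ← pow_add]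
    exact Even.neg_one_pow (Nat.even_add.mpr hvw)
  rw [Fin.prod_univ_five, h1', h2, h3, h4] at hprod
  have hone : t 0 = 1 := by
    linear_combination hprod - (t 0 ^ 2 + 1) * t 0 * htsq 0
  have hall : ∀ a, t a = 1 := by
    intro a
    fin_cases a
    · exact hone
    · exact h1'.trans (h2.trans (h3.trans (h4.trans hone)))
    · exact h2.trans (h3.trans (h4.trans hone))
    · exact h3.trans (h4.trans hone)
    · exact h4.trans hone
  funext a
  refine sgn_injective (mul_right_cancel₀ (sgn_ne_zero (w a)) ?_)
  rw [← sq, sgn_sq]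
  exact hall a

/-- A black vertex of a face. -/
def Face.black (f : Face) : Vertex :=
  if Even (heightFE f.1.2) then f.1.2 else nbr f.1.2 f.1.1

theorem Face.even_black (f : Face) : Even (heightFE f.black) := by
  unfold Face.black
  split_ifs with h
  · exact h
  · rwa [even_heightFE_nbr]

theorem black_of_even {v : Vertex} (hv : Even (heightFE v)) (j : Color) :
    v = (face j v).black ∨ v = nbr (nbr (face j v).black j) (j + 1) := by
  unfold Face.black
  change v = (if Even (heightFE (face j v).1.2) then (face j v).1.2 else nbr (face j v).1.2 j) ∨
    v = nbr (nbr (if Even (heightFE (face j v).1.2) then (face j v).1.2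
      else nbr (face j v).1.2 j) j) (j + 1)
  have hb := base_cases j v
  set b := (face j v).1.2
  rcases hb with h | h | h | h <;> rw [h] at hv ⊢
  · rw [if_pos hv]; exact .inl rfl
  · rw [even_heightFE_nbr] at hv
    rw [if_neg hv]; exact .inl rfl
  · rw [even_heightFE_nbr] at hv
    rw [if_neg hv, nbr_nbr_self]; exact .inr rfl
  · rw [even_heightFE_nbr, even_heightFE_nbr, not_not] at hv
    rw [if_pos hv]; exact .inr rfl

theorem black_joinedOver {j : Color} {P Q : Curve} {v : Vertex} (hv : Even (heightFE v))
    (hP : Represents (vertexCoord v) P)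
    (hQ : Represents (fun a => vertexCoord v a * blackCenter j a) Q) :
    JoinedOver (blackRay j) P Q := by
  refine joinedOver_of_lift (continuous_blackLift j) (blackLift_sq j) (blackLift_zero j)
    (blackLift_ne_zero (a := j) (by simp)) (vertexCoord_ne_zero v j) (ρ := 1) (fun a => ?_) hP
    (by simpa only [blackLift_one] using hQ)
  rw [vertexCoord_sq_even hv, mul_one, one_mul]

theorem white_joinedOver {j : Color} {P Q : Curve} {v : Vertex} (hv : ¬ Even (heightFE v))
    (hP : Represents (vertexCoord v) P)
    (hQ : Represents (fun a => vertexCoord v a * whiteCenter j a) Q) :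
    JoinedOver (whiteRay j) P Q := by
  refine joinedOver_of_lift (continuous_whiteLift j) (whiteLift_sq j) (whiteLift_zero j)
    (whiteLift_ne_zero (a := j) (by simp)) (vertexCoord_ne_zero v j)
    (ρ := -zeta ^ (18 * j.val + 126)) (fun a => ?_) hP
    (by simpa only [whiteLift_one] using hQ)
  -- Modulo `10` the exponent `8 a + 9 (2 j + 14 - 2 a)` is independent of `a`, which explains the
  -- chosen `ρ`.
  have h : zeta ^ (8 * a.val) * zeta ^ (9 * centerExponent j a) = zeta ^ (18 * j.val + 126) := by
    rw [← pow_add]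
    exact zeta_pow_congr ((by decide : ∀ j a : Color,
      (8 * a.val + 9 * (2 * j.val + 1 + (13 - 2 * a.val))) % 10 = (18 * j.val + 126) % 10) j a)
  rw [vertexCoord_sq_odd hv, whiteWeight]
  linear_combination -weight a * h

theorem edge_joinedOver {j : Color} {P Q : Curve} {v : Vertex} (hv : Even (heightFE v))
    (hP : Represents (vertexCoord v) P) (hQ : Represents (vertexCoord (nbr v j)) Q) :
    JoinedOver (edgeRay j) P Q := by
  refine joinedOver_of_lift (continuous_edgeLift j) (edgeLift_sq j) (edgeLift_zero j)
    (fun t => edgeLift_ne_zero j t 0) (vertexCoord_ne_zero v 0) (ρ := 1) (fun a => ?_) hP ?_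
  · rw [vertexCoord_sq_even hv, mul_one, one_mul]
  · convert hQ.smul (pow_ne_zero (j.val + 4) (neg_ne_zero.mpr zeta_ne_zero)) using 1
    funext a
    rw [Pi.smul_apply, smul_eq_mul, vertexCoord_nbr hv, edgeLift_one]
    ring

theorem nonempty_embedding : Nonempty Embedding := by
  have hne : ∀ {x : Color → ℂ} (a : Color), x a ≠ 0 → x ≠ 0 := fun a h h0 => h (by rw [h0]; rfl)
  have hV : ∀ v, ∃ P : Curve, Represents (vertexCoord v) P := by
    intro v
    refine exists_represents (hne 0 (vertexCoord_ne_zero v 0)) ?_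
    by_cases hv : Even (heightFE v)
    · refine onCurve_of_sq (ρ := 1) (u := 0) (w := 1) fun a => ?_
      rw [vertexCoord_sq_even hv, squareForm_black, one_mul]
    · refine onCurve_of_sq (ρ := -(zeta ^ 3)⁻¹) (u := 1) (w := 0) fun a => ?_
      have := pow_ne_zero 3 zeta_ne_zero
      rw [vertexCoord_sq_odd hv, squareForm_white, one_mul, neg_mul (zeta ^ 3), neg_mul_neg,
        inv_mul_cancel_left₀ this]
  have hF : ∀ f : Face, ∃ P : Curve,
      Represents (fun a => vertexCoord f.black a * blackCenter f.1.1 a) P := by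
    intro f
    refine exists_represents (hne f.1.1 (mul_ne_zero (vertexCoord_ne_zero _ _) ?_)) ?_
    · rw [← blackLift_one]
      exact blackLift_ne_zero (by simp) 1
    · refine onCurve_of_sq (ρ := 1) (u := (blackRay f.1.1 1).1) (w := (blackRay f.1.1 1).2)
        fun a => ?_
      rw [mul_pow, vertexCoord_sq_even f.even_black, ← blackLift_one, blackLift_sq, one_mul,
        one_mul, squareForm]
  choose V hV using hV
  choose F hF using hF
  have hblack : ∀ (v : Vertex) (j : Color), Even (heightFE v) →
      Represents (fun a => vertexCoord v a * blackCenter j a) (F (face j v)) := by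
    intro v j hv
    have h : Represents (fun a => vertexCoord (face j v).black a * blackCenter j a)
      (F (face j v)) := hF (face j v)
    rcases black_of_even hv j with h1 | h1
    · rwa [← h1] at h
    -- Opposite black corners differ by `-1` in all coordinates but `j+2`, and that one vanishes at
    -- the centre.
    · convert h.smul (neg_ne_zero.mpr one_ne_zero) using 1
      funext a
      conv_lhs => rw [h1, vertexCoord_nbr_nbr]
      rw [Pi.smul_apply, smul_eq_mul]
      split_ifs with ha
      · rw [ha, blackCenter_eq_zero]; ring
      · ring
  have hwhite : ∀ (v : Vertex) (j : Color), ¬ Even (heightFE v) →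
      Represents (fun a => vertexCoord v a * whiteCenter j a) (F (face j v)) := by
    intro v j hv
    have hu : Even (heightFE (nbr v j)) := (even_heightFE_nbr v j).mpr hv
    have h := hblack (nbr v j) j hu
    rw [face_nbr_left] at h
    convert h.smul (c := -Complex.I * zeta ^ (4 * (j.val + 2))) (mul_ne_zero
      (neg_ne_zero.mpr Complex.I_ne_zero) (pow_ne_zero _ zeta_ne_zero)) using 1
    funext a
    have hn := vertexCoord_nbr hu j a
    rw [nbr_nbr_self] at hn
    rw [Pi.smul_apply, smul_eq_mul, hn, mul_assoc, edgeFactor_mul_whiteCenter]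
    ring
  have hsqE : ∀ v, Even (heightFE v) → HasSquares weight (V v) := fun v hv =>
    ⟨_, 1, hV v, one_ne_zero, fun a => by rw [vertexCoord_sq_even hv, one_mul]⟩
  have hsqO : ∀ v, ¬ Even (heightFE v) → HasSquares whiteWeight (V v) := fun v hv =>
    ⟨_, 1, hV v, one_ne_zero, fun a => by rw [vertexCoord_sq_odd hv, one_mul]⟩
  refine ⟨⟨V, F, fun v w hvw => ?_, fun v j => ?_, fun v j => ?_⟩⟩
  · obtain ⟨c, -, hc⟩ := (hV v).exists_smul (hvw ▸ hV w)
    refine vertexCoord_injective ⟨fun h => ?_, fun h => ?_⟩ fun a => congrFun hc a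
    · by_contra hw
      exact (hsqE v h).black_ne_white (hvw ▸ hsqO w hw)
    · by_contra hv
      exact (hsqE w h).black_ne_white (hvw ▸ hsqO v hv)
  · by_cases hv : Even (heightFE v)
    · exact .inl (edge_joinedOver hv (hV v) (hV _))
    · refine .inr (edge_joinedOver ((even_heightFE_nbr v j).mpr hv) (hV _) ?_)
      rw [nbr_nbr_self]
      exact hV v
  · by_cases hv : Even (heightFE v)
    · exact .inl (black_joinedOver hv (hV v) (hblack v j hv))
    · exact .inr (white_joinedOver hv (hV v) (hwhite v j hv))

end Adinkra

namespace Adinkra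

/-! ### The group generated by the divisors -/

theorem Embedding.nuDiv_divisor (ε : Embedding) (k : Color) {h : Vertex → ℕ} (hh : IsHeight h) :
    nuDiv k (ε.divisor h) =
      pushSum (fun v => nu k (ε.vertex v)) (fun f => nu k (ε.center f)) h := by
  have h1 : nuDiv k (ε.divisor h) = (morseDivisor h).sum fun m n =>
      n • nu k (Sum.elim ε.vertex ε.center m) :=
    Finsupp.sum_mapDomain_index (h := fun p n => n • nu k p) (fun _ => zero_zsmul _)
      (fun _ _ _ => add_zsmul _ _ _)
  rw [h1, Finsupp.sum_fintype _ _ (fun _ => zero_zsmul _), Fintype.sum_sum_type, pushSum]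
  simp only [Sum.elim_inl, Sum.elim_inr, faceCoeff_eq hh, morseDivisor_inl]

theorem Embedding.divisor_group (ε : Embedding) (k : Color) :
    AddSubgroup.closure {P : (E k).Point | ∃ h, IsHeight h ∧ P = nuDiv k (ε.divisor h)} =
        AddSubgroup.zmultiples (nuDiv k (ε.divisor heightOne)) ∧
      nuDiv k (ε.divisor heightOne) =
        nu k (ε.vertex 1) - nu k (ε.center (face (k - 2) 1)) ∧
      Nonempty
        (AddSubgroup.closure {P : (E k).Point | ∃ h, IsHeight h ∧ P = nuDiv k (ε.divisor h)} ≃+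
          ℤ) := by
  have R := ε.configuration.morseRelations k
  have h1 : nuDiv k (ε.divisor heightOne) =
      nu k (ε.vertex 1) - nu k (ε.center (face (k - 2) 1)) := by
    rw [ε.nuDiv_divisor k isHeight_heightOne]
    exact R.pushSum_heightOne
  have h2 : AddSubgroup.closure {P : (E k).Point | ∃ h, IsHeight h ∧ P = nuDiv k (ε.divisor h)} =
      AddSubgroup.zmultiples (nuDiv k (ε.divisor heightOne)) := by
    refine le_antisymm ((AddSubgroup.closure_le _).mpr ?_) ?_
    · rintro _ ⟨h, hh, rfl⟩
      rw [ε.nuDiv_divisor k hh, h1]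
      exact R.pushSum_mem hh
    · rw [AddSubgroup.zmultiples_le]
      exact AddSubgroup.subset_closure ⟨heightOne, isHeight_heightOne, rfl⟩
  refine ⟨h2, h1, ?_⟩
  have hinj : Function.Injective (zmultiplesHom _ (nuDiv k (ε.divisor heightOne))) := by
    have h3 := ε.configuration.not_isOfFinAddOrder k
    rw [← h1] at h3
    exact injective_zsmul_iff_not_isOfFinAddOrder.mpr h3
  rw [h2]
  exact ⟨(AddMonoidHom.ofInjective hinj).symm⟩

end Adinkra

open Adinkra in
theorem mainTheorem6 :
    Nonempty Embedding ∧
    ∀ (ε : Embedding) (k : Color),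
      AddSubgroup.closure {P : (E k).Point | ∃ h, IsHeight h ∧ P = nuDiv k (ε.divisor h)} =
        AddSubgroup.zmultiples (nuDiv k (ε.divisor heightOne)) ∧
      nuDiv k (ε.divisor heightOne) =
        nu k (ε.vertex 1) - nu k (ε.center (face (k - 2) 1)) ∧
      Nonempty
        (AddSubgroup.closure {P : (E k).Point | ∃ h, IsHeight h ∧ P = nuDiv k (ε.divisor h)} ≃+ ℤ) :=
  ⟨nonempty_embedding, fun ε k => ε.divisor_group k⟩
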